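/- Let $1\le p<\infty$, $p\ne 2$, let $D$ be the open unit disc and $T$ the unit circle, and let $H^p$ be the Hardy space of analytic functions $f$ on $D$ with $\|f\|_p^p=\sup_{0<r<1}\int_T|f(r\zeta)|^p\,dm(\zeta)<\infty$, where $m$ is normalized Lebesgue measure on $T$. Let $$\phi(z)=\frac{\lambda(z-a)}{1-\overline a z},\qquad |\lambda|=1,\ a\in D,$$ be an automorphism of $D$ which is either parabolic (it has exactly one fixed point in $\overline D$, and this point lies on $T$) or hyperbolic (it is not the identity and has two distinct fixed points on $T$). Put $U_\phi f=(\overline\lambda\,\phi')^{1/p}\,(f\circ\phi)$, with the principal branch of the power, and $M_\Psi f=\Psi f$. An infinite Blaschke product is a function of the form $\prod_{k=1}^\infty b_k$, converging locally uniformly on $D$, where each $b_k$ is an automorphism of $D$ with zero $a_k$ and $\sum_k(1-|a_k|)<\infty$. For every infinite Blaschke product $\Psi$ the operator $S=M_\Psi U_\phi$ is a linear isometry of $H^p$ into itself whose range has infinite codimension in $H^p$. Depending on the choice of $\Psi$, both of the following occur: (i) there is an infinite Blaschke product $\Psi$ such that $\bigcap_{n=1}^\infty S^nH^p=\{0\}$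 for $S=M_\Psi U_\phi$; (ii) there is an infinite Blaschke product $\Psi$ such that $\bigcap_{n=1}^\infty S^nH^p\ne\{0\}$ for $S=M_\Psi U_\phi$. -/

import Mathlib

open scoped Complex.UnitDisc

namespace HardyIsometry

/-! ### Automorphisms of the unit disc -/

/-- A holomorphic automorphism `z ↦ λ (z - a) / (1 - conj a * z)` of the unit disc,
given by its (uniquely determined) parameters `a` in the open disc and `λ` on the unit circle. -/
structure DiscAut where
  /-- the zero of the automorphism -/
  a : 𝔻
  /-- the unimodular factor -/
  lam : Circle

/-- The Moebius formula of the automorphism, as a function on the plane.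
On the closed unit disc its denominator does not vanish. -/
noncomputable def DiscAut.eval (φ : DiscAut) (z : ℂ) : ℂ :=
  (φ.lam : ℂ) * (z - (φ.a : ℂ)) / (1 - (starRingEnd ℂ) (φ.a : ℂ) * z)

theorem DiscAut.norm_eval_lt_one (φ : DiscAut) (z : ℂ) (hz : ‖z‖ < 1) : ‖φ.eval z‖ < 1 := by
  have ha := φ.a.norm_lt_one
  have hd : ‖(starRingEnd ℂ) (φ.a : ℂ) * z‖ < 1 := by
    rw [norm_mul, RCLike.norm_conj]
    nlinarith [norm_nonneg z, norm_nonneg (φ.a : ℂ)]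
  have hne : (1 - (starRingEnd ℂ) (φ.a : ℂ) * z) ≠ 0 := by
    intro h
    rw [← sub_eq_zero.1 h, norm_one] at hd
    exact lt_irrefl _ hd
  rw [DiscAut.eval, norm_div, norm_mul, Circle.norm_coe, one_mul,
    div_lt_one (norm_pos_iff.2 hne)]
  refine lt_of_pow_lt_pow_left₀ 2 (norm_nonneg _) ?_
  have h1 : (φ.a : ℂ).re ^ 2 + (φ.a : ℂ).im ^ 2 < 1 := by
    have := φ.a.normSq_lt_one
    rw [Complex.normSq_apply] at this
    nlinarith
  have h2 : z.re ^ 2 + z.im ^ 2 < 1 := by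
    have : ‖z‖ ^ 2 < 1 := by nlinarith [norm_nonneg z]
    rw [← Complex.normSq_eq_norm_sq, Complex.normSq_apply] at this
    nlinarith
  rw [← Complex.normSq_eq_norm_sq, ← Complex.normSq_eq_norm_sq, Complex.normSq_apply,
    Complex.normSq_apply]
  simp only [Complex.sub_re, Complex.sub_im, Complex.one_re, Complex.one_im, Complex.mul_re,
    Complex.mul_im, Complex.conj_re, Complex.conj_im]
  nlinarith [mul_pos (sub_pos.2 h1) (sub_pos.2 h2)]

/-- The automorphism as a self-map of the open unit disc. -/
noncomputable def DiscAut.map (φ : DiscAut) (z : 𝔻) : 𝔻 :=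
  Complex.UnitDisc.mk (φ.eval z) (φ.norm_eval_lt_one z z.norm_lt_one)

/-- `φ` is parabolic: it has exactly one fixed point in the closed unit disc, and this point lies
on the unit circle. -/
def DiscAut.IsParabolic (φ : DiscAut) : Prop :=
  ∃ w : ℂ, ‖w‖ = 1 ∧ ∀ z : ℂ, ‖z‖ ≤ 1 → (φ.eval z = z ↔ z = w)

/-- `φ` is hyperbolic: it is not the identity and has two distinct fixed points on the unit
circle. -/
def DiscAut.IsHyperbolic (φ : DiscAut) : Prop :=
  (∃ z : 𝔻, φ.map z ≠ z) ∧
    ∃ w₁ w₂ : ℂ, w₁ ≠ w₂ ∧ ‖w₁‖ = 1 ∧ ‖w₂‖ = 1 ∧ φ.eval w₁ = w₁ ∧ φ.eval w₂ = w₂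

/-! ### Hardy spaces -/

open Classical in
/-- Extension by zero of a function on the open unit disc to the plane. -/
noncomputable def zeroExt (f : 𝔻 → ℂ) (z : ℂ) : ℂ :=
  if hz : ‖z‖ < 1 then f (Complex.UnitDisc.mk z hz) else 0

/-- `f` is analytic on the open unit disc. -/
def IsAnalytic (f : 𝔻 → ℂ) : Prop :=
  DifferentiableOn ℂ (zeroExt f) (Metric.ball 0 1)

/-- The mean of `|f| ^ p` over the circle of radius `r` with respect to normalized Lebesgue
measure. -/
noncomputable def hpMean (p : ℝ) (f : 𝔻 → ℂ) (r : ℝ) : ℝ :=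
  Real.circleAverage (fun z : ℂ => ‖zeroExt f z‖ ^ p) 0 r

/-- The Hardy space norm: the supremum over `0 < r < 1` of the `p`-th means, to the power `1/p`. -/
noncomputable def hpNorm (p : ℝ) (f : 𝔻 → ℂ) : ℝ :=
  (⨆ r : Set.Ioo (0 : ℝ) 1, hpMean p f r) ^ (1 / p)

theorem circleIntegrable_of_isAnalytic {p : ℝ} (hp : 1 ≤ p) {f : 𝔻 → ℂ} (hf : IsAnalytic f)
    {r : ℝ} (hr : r ∈ Set.Ioo (0 : ℝ) 1) :
    CircleIntegrable (fun z : ℂ => ‖zeroExt f z‖ ^ p) 0 r := by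
  refine ContinuousOn.circleIntegrable hr.1.le ?_
  refine ContinuousOn.rpow_const ?_ (fun _ _ => Or.inr (by linarith))
  refine (hf.continuousOn.mono ?_).norm
  exact (Metric.sphere_subset_closedBall).trans (Metric.closedBall_subset_ball hr.2)

theorem zeroExt_add (f g : 𝔻 → ℂ) : zeroExt (f + g) = zeroExt f + zeroExt g := by
  funext z
  simp only [zeroExt, Pi.add_apply]
  split_ifs <;> simp

theorem zeroExt_smul (c : ℂ) (f : 𝔻 → ℂ) : zeroExt (c • f) = c • zeroExt f := by
  funext z
  simp only [zeroExt, Pi.smul_apply]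
  split_ifs <;> simp

theorem zeroExt_zero : zeroExt 0 = 0 := by
  funext z
  simp [zeroExt]

/-- The Hardy space `H^p` of the unit disc: the analytic functions whose `p`-th means over the
circles of radius `0 < r < 1` are bounded. -/
noncomputable def Hp (p : ℝ) (hp : 1 ≤ p) : Submodule ℂ (𝔻 → ℂ) where
  carrier := {f | IsAnalytic f ∧ ∃ C : ℝ, ∀ r ∈ Set.Ioo (0 : ℝ) 1, hpMean p f r ≤ C}
  zero_mem' := by
    refine ⟨?_, 0, fun r _ => ?_⟩
    · rw [IsAnalytic, zeroExt_zero]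
      exact differentiableOn_const 0
    · have h0 : (0 : ℝ) ^ p = 0 := Real.zero_rpow (by linarith)
      simp [hpMean, zeroExt_zero, h0, Real.circleAverage_const]
  add_mem' := by
    rintro f g ⟨hf, C, hC⟩ ⟨hg, D, hD⟩
    have hfg : IsAnalytic (f + g) := by
      rw [IsAnalytic, zeroExt_add]
      exact hf.add hg
    refine ⟨hfg, 2 ^ p * (C + D), fun r hr => ?_⟩
    have If := circleIntegrable_of_isAnalytic hp hf hr
    have Ig := circleIntegrable_of_isAnalytic hp hg hr
    have key : hpMean p (f + g) r ≤
        Real.circleAverage ((2 : ℝ) ^ p • ((fun z : ℂ => ‖zeroExt f z‖ ^ p) +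
          (fun z : ℂ => ‖zeroExt g z‖ ^ p))) 0 r := by
      refine Real.circleAverage_mono (circleIntegrable_of_isAnalytic hp hfg hr)
        ((If.add Ig).const_smul) (fun z _ => ?_)
      simp only [zeroExt_add, Pi.add_apply, Pi.smul_apply, smul_eq_mul]
      set x := zeroExt f z
      set y := zeroExt g z
      have hp0 : 0 ≤ p := by linarith
      have h1 : ‖x + y‖ ≤ 2 * max ‖x‖ ‖y‖ := by
        have := norm_add_le x y
        have := le_max_left ‖x‖ ‖y‖
        have := le_max_right ‖x‖ ‖y‖
        linarith
      have hm : 0 ≤ max ‖x‖ ‖y‖ := (norm_nonneg x).trans (le_max_left _ _)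
      refine (Real.rpow_le_rpow (norm_nonneg _) h1 hp0).trans ?_
      rw [Real.mul_rpow (by norm_num) hm]
      refine mul_le_mul_of_nonneg_left ?_ (by positivity)
      have hx : 0 ≤ ‖x‖ ^ p := by positivity
      have hy : 0 ≤ ‖y‖ ^ p := by positivity
      rcases max_choice ‖x‖ ‖y‖ with h | h <;> rw [h] <;> linarith
    rw [Real.circleAverage_smul, Real.circleAverage_add If Ig, smul_eq_mul] at key
    refine key.trans (mul_le_mul_of_nonneg_left ?_ (by positivity))
    exact add_le_add (hC r hr) (hD r hr)
  smul_mem' := by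
    rintro c f ⟨hf, C, hC⟩
    refine ⟨?_, ‖c‖ ^ p * C, fun r hr => ?_⟩
    · rw [IsAnalytic, zeroExt_smul]
      exact hf.const_smul c
    · have h : (fun z : ℂ => ‖zeroExt (c • f) z‖ ^ p) =
          (‖c‖ ^ p) • (fun z : ℂ => ‖zeroExt f z‖ ^ p) := by
        funext z
        rw [zeroExt_smul]
        simp [Real.mul_rpow (norm_nonneg _) (norm_nonneg _)]
      rw [hpMean, h, Real.circleAverage_smul, smul_eq_mul]
      exact mul_le_mul_of_nonneg_left (hC r hr) (by positivity)

/-! ### The operators -/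

/-- Multiplication `f ↦ Ψ f`. -/
noncomputable def mulOp (Ψ : 𝔻 → ℂ) : Module.End ℂ (𝔻 → ℂ) := LinearMap.mulLeft ℂ Ψ

/-- Composition `f ↦ f ∘ φ`. -/
noncomputable def compOp (φ : DiscAut) : Module.End ℂ (𝔻 → ℂ) := LinearMap.funLeft ℂ ℂ φ.map

/-- The weight `(conj λ * φ')^(1/p)`, with the principal branch of the power. -/
noncomputable def weight (p : ℝ) (φ : DiscAut) (z : 𝔻) : ℂ :=
  ((starRingEnd ℂ) (φ.lam : ℂ) * deriv φ.eval z) ^ (((1 / p : ℝ)) : ℂ)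

/-- `U_φ f = (conj λ * φ')^(1/p) * (f ∘ φ)`. -/
noncomputable def U (p : ℝ) (φ : DiscAut) : Module.End ℂ (𝔻 → ℂ) :=
  mulOp (weight p φ) * compOp φ

/-- The linear operator `S` maps `H^p` into `H^p` isometrically. -/
def IsHpIsometry (p : ℝ) (hp : 1 ≤ p) (S : Module.End ℂ (𝔻 → ℂ)) : Prop :=
  ∀ f ∈ Hp p hp, S f ∈ Hp p hp ∧ hpNorm p (S f) = hpNorm p f

/-- The image `S H^p` has infinite codimension in `H^p`. -/
def HasInfiniteCodim (p : ℝ) (hp : 1 ≤ p) (S : Module.End ℂ (𝔻 → ℂ)) : Prop :=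
  ¬ FiniteDimensional ℂ (Hp p hp ⧸ ((Hp p hp).map S).submoduleOf (Hp p hp))

/-! ### Infinite Blaschke products -/

/-- `Ψ` is an infinite Blaschke product: a locally uniformly convergent product of infinitely many
disc automorphisms (each carrying its own unimodular factor) whose zeros `aₖ` satisfy the Blaschke
condition `∑ (1 - |aₖ|) < ∞`. -/
def IsInfiniteBlaschkeProduct (Ψ : 𝔻 → ℂ) : Prop :=
  ∃ b : ℕ → DiscAut, Summable (fun k => 1 - ‖((b k).a : ℂ)‖) ∧
    TendstoLocallyUniformly (fun (n : ℕ) (z : 𝔻) => ∏ k ∈ Finset.range n, (b k).eval z) Ψ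
      Filter.atTop

end HardyIsometry

/-!
On the unit circle the weight of `U φ` satisfies `|weight| ^ p = |φ'|`, so `U φ` preserves boundary
`L^p` means; applied to the dilations of `f` this makes `U φ`, and likewise its inverse `U φ⁻¹`, a
contraction of `H^p`. Multiplication by the coordinate is isometric, hence, after conjugation with
`U`, so is multiplication by any automorphism, and by any Blaschke product, since the tails of the
product tend to one. Functions in the range of `S = M_Ψ U_φ` vanish at the infinitely many zeros of
`Ψ`, while polynomials interpolate arbitrary values there.

Sending a boundary fixed point to infinity turns `φ` into an affine map of a half-plane, which shows
that every orbit satisfies the Blaschke condition `∑ (1 - |φⁿ c|) < ∞`. Moreover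
`Sⁿ g = (∏ j < n, Ψ ∘ φʲ) * Uⁿ g`. If each point of some sequence `c k → 0` has an iterate among the
zeros of `Ψ`, then a function in all the ranges vanishes at every `c k`, so it is zero. If instead
the zeros of `Ψ` are so sparse that `∑ (1 - |Ψ (φʲ 0)|) < ∞` with no `Ψ (φʲ 0)` equal to zero, then
the suitably normalized product `∏ j, Ψ ∘ φʲ` converges to a non-zero function in all the ranges.
-/

namespace HardyIsometry

open Filter Topology Real ComplexConjugate

theorem norm_conj_mul_lt_one {a z : ℂ} (ha : ‖a‖ < 1) (hz : ‖z‖ ≤ 1) : ‖conj a * z‖ < 1 := by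
  rw [norm_mul, RCLike.norm_conj]
  exact mul_lt_one_of_nonneg_of_lt_one_left (norm_nonneg a) ha hz

theorem one_sub_conj_mul_ne_zero {a z : ℂ} (ha : ‖a‖ < 1) (hz : ‖z‖ ≤ 1) : 1 - conj a * z ≠ 0 :=
  fun h => (norm_conj_mul_lt_one ha hz).ne (by rw [← sub_eq_zero.1 h, norm_one])

theorem sq_norm_one_sub_conj_mul_sub (a z : ℂ) :
    ‖1 - conj a * z‖ ^ 2 - ‖z - a‖ ^ 2 = (1 - ‖a‖ ^ 2) * (1 - ‖z‖ ^ 2) := by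
  simp only [← Complex.normSq_eq_norm_sq, Complex.normSq_apply, Complex.sub_re, Complex.sub_im,
    Complex.one_re, Complex.one_im, Complex.mul_re, Complex.mul_im, Complex.conj_re,
    Complex.conj_im]
  ring

theorem ne_coe_of_norm_eq_one {w : ℂ} (hw : ‖w‖ = 1) (z : 𝔻) : w ≠ z := fun h =>
  z.norm_ne_one (h ▸ hw)

/-! ### Disc automorphisms -/

namespace DiscAut

variable (φ : DiscAut)

@[simp] theorem coe_map (z : 𝔻) : ((φ.map z : 𝔻) : ℂ) = φ.eval z := rfl

theorem one_sub_sq_norm_a_pos : 0 < 1 - ‖(φ.a : ℂ)‖ ^ 2 := sub_pos.2 φ.a.sq_norm_lt_one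

theorem one_sub_sq_norm_a_ne_zero : 1 - (‖(φ.a : ℂ)‖ : ℂ) ^ 2 ≠ 0 := by
  exact_mod_cast φ.one_sub_sq_norm_a_pos.ne'

theorem den_ne_zero {z : ℂ} (hz : ‖z‖ ≤ 1) : 1 - conj (φ.a : ℂ) * z ≠ 0 :=
  one_sub_conj_mul_ne_zero φ.a.norm_lt_one hz

theorem conj_lam_mul_lam : conj (φ.lam : ℂ) * φ.lam = 1 := by
  rw [← Circle.coe_inv_eq_conj, ← Circle.coe_mul, inv_mul_cancel, Circle.coe_one]

theorem norm_eval (z : ℂ) : ‖φ.eval z‖ = ‖z - φ.a‖ / ‖1 - conj (φ.a : ℂ) * z‖ := by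
  rw [eval, norm_div, norm_mul, Circle.norm_coe, one_mul]

theorem one_sub_sq_norm_eval {z : ℂ} (hz : ‖z‖ ≤ 1) :
    1 - ‖φ.eval z‖ ^ 2 =
      (1 - ‖(φ.a : ℂ)‖ ^ 2) * (1 - ‖z‖ ^ 2) / ‖1 - conj (φ.a : ℂ) * z‖ ^ 2 := by
  have h := norm_pos_iff.2 (φ.den_ne_zero hz)
  rw [norm_eval, ← sq_norm_one_sub_conj_mul_sub, sub_div, div_self (by positivity), div_pow]

theorem norm_eval_eq_one {z : ℂ} (hz : ‖z‖ = 1) : ‖φ.eval z‖ = 1 := by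
  have h := φ.one_sub_sq_norm_eval hz.le
  rw [hz, one_pow, sub_self, mul_zero, zero_div, sub_eq_zero] at h
  exact (pow_eq_one_iff_of_nonneg (norm_nonneg _) two_ne_zero).1 h.symm

theorem norm_eval_le_one {z : ℂ} (hz : ‖z‖ ≤ 1) : ‖φ.eval z‖ ≤ 1 :=
  hz.lt_or_eq.elim (fun h => (φ.norm_eval_lt_one z h).le) fun h => (φ.norm_eval_eq_one h).le

theorem hasDerivAt_eval {z : ℂ} (hz : ‖z‖ ≤ 1) :
    HasDerivAt φ.eval
      (φ.lam * (1 - (‖(φ.a : ℂ)‖ : ℂ) ^ 2) / (1 - conj (φ.a : ℂ) * z) ^ 2) z := by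
  have hnum : HasDerivAt (fun z : ℂ => φ.lam * (z - φ.a)) φ.lam z := by
    simpa using ((hasDerivAt_id z).sub_const (φ.a : ℂ)).const_mul (φ.lam : ℂ)
  have hden : HasDerivAt (fun z : ℂ => 1 - conj (φ.a : ℂ) * z) (-conj (φ.a : ℂ)) z := by
    simpa using ((hasDerivAt_id z).const_mul (conj (φ.a : ℂ))).const_sub 1
  refine (hnum.div hden (φ.den_ne_zero hz)).congr_deriv ?_
  rw [← Complex.conj_mul']
  ring

theorem differentiableOn_eval : DifferentiableOn ℂ φ.eval (Metric.closedBall 0 1) := fun _ hz =>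
  (φ.hasDerivAt_eval (mem_closedBall_zero_iff.1 hz)).differentiableAt.differentiableWithinAt

theorem eval_sub_eval {z w : ℂ} (hz : ‖z‖ ≤ 1) (hw : ‖w‖ ≤ 1) :
    φ.eval z - φ.eval w = φ.lam * (1 - (‖(φ.a : ℂ)‖ : ℂ) ^ 2) * (z - w) /
      ((1 - conj (φ.a : ℂ) * z) * (1 - conj (φ.a : ℂ) * w)) := by
  rw [eval, eval, ← Complex.conj_mul', div_sub_div _ _ (φ.den_ne_zero hz) (φ.den_ne_zero hw)]
  ring

theorem one_sub_conj_eval_mul_eval {z w : ℂ} (hz : ‖z‖ ≤ 1) (hw : ‖w‖ ≤ 1) :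
    1 - conj (φ.eval w) * φ.eval z = (1 - (‖(φ.a : ℂ)‖ : ℂ) ^ 2) * (1 - conj w * z) /
      (conj (1 - conj (φ.a : ℂ) * w) * (1 - conj (φ.a : ℂ) * z)) := by
  have hdz := φ.den_ne_zero hz
  have hdw : conj (1 - conj (φ.a : ℂ) * w) ≠ 0 := (map_ne_zero _).2 (φ.den_ne_zero hw)
  rw [eval, eval, map_div₀, div_mul_div_comm, sub_eq_iff_eq_add, ← add_div,
    eq_div_iff (mul_ne_zero hdw hdz), ← Complex.conj_mul']
  simp only [map_mul, map_sub, map_one, Complex.conj_conj]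
  linear_combination (-(conj w - conj (φ.a : ℂ)) * (z - φ.a)) * φ.conj_lam_mul_lam

/-- The inverse automorphism. -/
noncomputable def inv : DiscAut where
  a := -(φ.lam • φ.a)
  lam := φ.lam⁻¹

theorem inv_a : ((φ.inv.a : 𝔻) : ℂ) = -((φ.lam : ℂ) * φ.a) := by
  simp only [inv, Complex.UnitDisc.coe_neg, Complex.UnitDisc.coe_circle_smul]

theorem inv_lam : (φ.inv.lam : ℂ) = conj (φ.lam : ℂ) := Circle.coe_inv_eq_conj _

theorem inv_inv : φ.inv.inv = φ := by
  have ha : φ.lam⁻¹ • -(φ.lam • φ.a) = -φ.a := by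
    simp [← Complex.UnitDisc.coe_inj]
  cases φ
  simp only [inv, _root_.inv_inv, ha, neg_neg]

theorem inv_den {z : ℂ} (hz : ‖z‖ ≤ 1) :
    1 - conj (φ.inv.a : ℂ) * φ.eval z =
      (1 - (‖(φ.a : ℂ)‖ : ℂ) ^ 2) / (1 - conj (φ.a : ℂ) * z) := by
  have hdz := φ.den_ne_zero hz
  rw [inv_a, eval, ← Complex.conj_mul', map_neg, map_mul, eq_div_iff hdz, sub_mul, mul_assoc,
    div_mul_cancel₀ _ hdz]
  linear_combination conj (φ.a : ℂ) * (z - φ.a) * φ.conj_lam_mul_lam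

theorem inv_eval_eval {z : ℂ} (hz : ‖z‖ ≤ 1) : φ.inv.eval (φ.eval z) = z := by
  have hdz := φ.den_ne_zero hz
  have hnum : φ.inv.lam * (φ.eval z - φ.inv.a) =
      (1 - (‖(φ.a : ℂ)‖ : ℂ) ^ 2) * z / (1 - conj (φ.a : ℂ) * z) := by
    rw [inv_lam, inv_a, eval, ← Complex.conj_mul', eq_div_iff hdz, mul_assoc, sub_mul,
      div_mul_cancel₀ _ hdz]
    linear_combination (z - φ.a + φ.a * (1 - conj (φ.a : ℂ) * z)) * φ.conj_lam_mul_lam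
  rw [eval, φ.inv_den hz, hnum, div_div_div_cancel_right₀ hdz,
    mul_div_cancel_left₀ _ φ.one_sub_sq_norm_a_ne_zero]

theorem inv_map_map (z : 𝔻) : φ.inv.map (φ.map z) = z :=
  Complex.UnitDisc.coe_inj.1 (φ.inv_eval_eval z.norm_lt_one.le)

theorem map_inv_map (z : 𝔻) : φ.map (φ.inv.map z) = z := by
  simpa only [inv_inv] using φ.inv.inv_map_map z

/-- The automorphism `z ↦ (z - a) / (1 - conj a * z)`, whose modulus is the pseudo-hyperbolic
distance to `a`. -/
noncomputable def ofZero (a : 𝔻) : DiscAut := ⟨a, 1⟩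

theorem norm_ofZero_eval (w z : 𝔻) :
    ‖(ofZero w).eval z‖ = ‖(z - w : ℂ)‖ / ‖1 - conj (w : ℂ) * z‖ := norm_eval _ _

theorem norm_ofZero_map_eval_map (z w : 𝔻) :
    ‖(ofZero (φ.map w)).eval (φ.map z)‖ = ‖(ofZero w).eval z‖ := by
  have hz := z.norm_lt_one.le
  have hw := w.norm_lt_one.le
  have hdz := norm_ne_zero_iff.2 (φ.den_ne_zero hz)
  have hdw := norm_ne_zero_iff.2 (φ.den_ne_zero hw)
  have hzw := norm_ne_zero_iff.2 (one_sub_conj_mul_ne_zero w.norm_lt_one hz)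
  have ha := norm_ne_zero_iff.2 φ.one_sub_sq_norm_a_ne_zero
  rw [norm_ofZero_eval, norm_ofZero_eval, coe_map, coe_map, φ.eval_sub_eval hz hw,
    φ.one_sub_conj_eval_mul_eval hz hw]
  simp only [norm_div, norm_mul, Circle.norm_coe, one_mul, RCLike.norm_conj]
  generalize ‖1 - conj (φ.a : ℂ) * z‖ = dz, ‖1 - conj (φ.a : ℂ) * w‖ = dw,
    ‖1 - conj (w : ℂ) * z‖ = zw at hdz hdw hzw ⊢
  field_simp

theorem norm_ofZero_iterate_inv (m : ℕ) (z : 𝔻) :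
    ‖(ofZero (φ.inv.map^[m] 0)).eval z‖ = ‖(φ.map^[m] z : ℂ)‖ := by
  induction m generalizing z with
  | zero => simp [norm_ofZero_eval]
  | succ m ih =>
    rw [Function.iterate_succ_apply', Function.iterate_succ_apply, ← ih,
      ← φ.norm_ofZero_map_eval_map, map_inv_map]

end DiscAut

/-! ### Dynamics of automorphisms with a boundary fixed point -/

/-- The Cayley transform mapping the disc onto the right half-plane and the boundary point `w` to
infinity. -/
noncomputable def cayley (w z : ℂ) : ℂ := (w + z) / (w - z)

section Cayley

variable {w z : ℂ}

theorem cayley_add_one (h : w ≠ z) : cayley w z + 1 = 2 * w / (w - z) := by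
  rw [cayley, div_add_one (sub_ne_zero.2 h)]
  ring

theorem re_cayley (hw : ‖w‖ = 1) : (cayley w z).re = (1 - ‖z‖ ^ 2) / ‖w - z‖ ^ 2 := by
  have hw2 : ‖w‖ ^ 2 = 1 := by rw [hw, one_pow]
  rw [cayley, Complex.div_re, ← Complex.normSq_eq_norm_sq (w - z), ← add_div, ← hw2,
    ← Complex.normSq_eq_norm_sq, ← Complex.normSq_eq_norm_sq, Complex.normSq_apply w,
    Complex.normSq_apply z]
  congr 1
  simp only [Complex.add_re, Complex.add_im, Complex.sub_re, Complex.sub_im]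
  ring

theorem one_sub_sq_norm_eq_cayley (hw : ‖w‖ = 1) (h : w ≠ z) :
    1 - ‖z‖ ^ 2 = 4 * (cayley w z).re / ‖cayley w z + 1‖ ^ 2 := by
  have hwz : ‖w - z‖ ≠ 0 := norm_ne_zero_iff.2 (sub_ne_zero.2 h)
  rw [cayley_add_one h, re_cayley hw, norm_div, norm_mul, hw, Complex.norm_two]
  field_simp
  norm_num

theorem re_cayley_add_one_le (w z : ℂ) : (cayley w z).re + 1 ≤ ‖cayley w z + 1‖ := by
  simpa only [Complex.add_re, Complex.one_re] using Complex.re_le_norm (cayley w z + 1)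

end Cayley

theorem injective_cayley {w : ℂ} (hw : ‖w‖ = 1) :
    Function.Injective fun z : 𝔻 => cayley w z := by
  intro z z' h
  have hz := ne_coe_of_norm_eq_one hw z
  have hz' := ne_coe_of_norm_eq_one hw z'
  have hw0 : 2 * w ≠ 0 := mul_ne_zero two_ne_zero (norm_ne_zero_iff.1 (hw ▸ one_ne_zero))
  have h1 : 2 * w / (w - z) = 2 * w / (w - z') := by
    rw [← cayley_add_one hz, ← cayley_add_one hz']
    exact congrArg (· + 1) h
  rw [div_eq_div_iff (sub_ne_zero.2 hz) (sub_ne_zero.2 hz'), mul_right_inj' hw0] at h1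
  exact Complex.UnitDisc.coe_inj.1 (sub_right_injective h1).symm

section CayleyUnitDisc

variable {w : ℂ} (hw : ‖w‖ = 1) (z : 𝔻)
include hw

theorem re_cayley_pos : 0 < (cayley w z).re := by
  rw [re_cayley hw]
  have hwz := norm_pos_iff.2 (sub_ne_zero.2 (ne_coe_of_norm_eq_one hw z))
  exact div_pos (sub_pos.2 z.sq_norm_lt_one) (by positivity)

theorem one_sub_norm_le_cayley :
    1 - ‖(z : ℂ)‖ ≤ 4 * (cayley w z).re / ‖cayley w z + 1‖ ^ 2 := by
  rw [← one_sub_sq_norm_eq_cayley hw (ne_coe_of_norm_eq_one hw z)]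
  exact sub_le_sub_left (pow_le_of_le_one (norm_nonneg _) z.norm_lt_one.le two_ne_zero) 1

theorem one_sub_norm_le_four_mul_re_cayley : 1 - ‖(z : ℂ)‖ ≤ 4 * (cayley w z).re := by
  have hre := re_cayley_pos hw z
  have hone : 1 ≤ ‖cayley w z + 1‖ := by linarith [re_cayley_add_one_le w z]
  exact (one_sub_norm_le_cayley hw z).trans (div_le_self (by positivity) (one_le_pow₀ hone))

theorem one_sub_norm_le_four_mul_inv_re_cayley : 1 - ‖(z : ℂ)‖ ≤ 4 * (cayley w z).re⁻¹ := by
  have hre := re_cayley_pos hw z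
  have hle : (cayley w z).re ≤ ‖cayley w z + 1‖ := by linarith [re_cayley_add_one_le w z]
  calc 1 - ‖(z : ℂ)‖ ≤ 4 * (cayley w z).re / ‖cayley w z + 1‖ ^ 2 := one_sub_norm_le_cayley hw z
    _ ≤ 4 * (cayley w z).re / (cayley w z).re ^ 2 := by gcongr
    _ = 4 * (cayley w z).re⁻¹ := by field_simp

theorem one_sub_norm_le_four_mul_re_div_sq_im_cayley (him : (cayley w z).im ≠ 0) :
    1 - ‖(z : ℂ)‖ ≤ 4 * (cayley w z).re / (cayley w z).im ^ 2 := by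
  have hre := re_cayley_pos hw z
  have hle : |(cayley w z).im| ≤ ‖cayley w z + 1‖ := by
    simpa only [Complex.add_im, Complex.one_im, add_zero] using
      Complex.abs_im_le_norm (cayley w z + 1)
  refine (one_sub_norm_le_cayley hw z).trans ?_
  rw [← sq_abs (cayley w z).im]
  gcongr

end CayleyUnitDisc

namespace DiscAut

variable (φ : DiscAut) {w : ℂ} (hw : ‖w‖ = 1) (hfix : φ.eval w = w)
include hw hfix

theorem cayley_eval_add_one (z : 𝔻) :
    cayley w (φ.eval z) + 1 =
      2 * (w - φ.a) * (1 - conj (φ.a : ℂ) * z) / ((1 - (‖(φ.a : ℂ)‖ : ℂ) ^ 2) * (w - z)) := by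
  have hwz : w - z ≠ 0 := sub_ne_zero.2 (ne_coe_of_norm_eq_one hw z)
  have hdw := φ.den_ne_zero hw.le
  have hdz := φ.den_ne_zero z.norm_lt_one.le
  have ha := φ.one_sub_sq_norm_a_ne_zero
  have hlam : φ.lam * (w - φ.a) = w * (1 - conj (φ.a : ℂ) * w) := by
    rwa [eval, div_eq_iff hdw] at hfix
  have hsub : w - φ.eval z = φ.lam * (1 - (‖(φ.a : ℂ)‖ : ℂ) ^ 2) * (w - z) /
      ((1 - conj (φ.a : ℂ) * w) * (1 - conj (φ.a : ℂ) * z)) := by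
    rw [← φ.eval_sub_eval hw.le z.norm_lt_one.le, hfix]
  have hne : w ≠ φ.eval z := ne_coe_of_norm_eq_one hw (φ.map z)
  rw [cayley_add_one hne, hsub, div_div_eq_mul_div,
    div_eq_div_iff (mul_ne_zero (mul_ne_zero (Circle.coe_ne_zero _) ha) hwz)
      (mul_ne_zero ha hwz)]
  linear_combination (-2 * (1 - conj (φ.a : ℂ) * z) * (1 - (‖(φ.a : ℂ)‖ : ℂ) ^ 2) * (w - z)) *
    hlam

/-- Conjugated to the half-plane, `φ` fixes infinity and is therefore affine. -/
theorem exists_cayley_map : ∃ A B : ℝ, 0 < A ∧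
    ∀ z : 𝔻, cayley w (φ.map z) = A * cayley w z + B * Complex.I := by
  have hwa : w - φ.a ≠ 0 := sub_ne_zero.2 (ne_coe_of_norm_eq_one hw _)
  have ha := φ.one_sub_sq_norm_a_ne_zero
  refine ⟨‖w - φ.a‖ ^ 2 / (1 - ‖(φ.a : ℂ)‖ ^ 2),
    2 * (conj (φ.a : ℂ) * w).im / (1 - ‖(φ.a : ℂ)‖ ^ 2),
    div_pos (pow_pos (norm_pos_iff.2 hwa) 2) φ.one_sub_sq_norm_a_pos, fun z => ?_⟩
  have hwz : w - z ≠ 0 := sub_ne_zero.2 (ne_coe_of_norm_eq_one hw z)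
  have hww : conj w * w = 1 := by rw [Complex.conj_mul', hw, Complex.ofReal_one, one_pow]
  have him : (2 * (conj (φ.a : ℂ) * w).im : ℂ) * Complex.I =
      conj (φ.a : ℂ) * w - φ.a * conj w := by
    have h := Complex.sub_conj (conj (φ.a : ℂ) * w)
    rw [map_mul, Complex.conj_conj] at h
    rw [h]
    push_cast
    ring
  rw [coe_map, eq_sub_of_add_eq (φ.cayley_eval_add_one hw hfix z), cayley]
  push_cast
  rw [div_mul_eq_mul_div _ _ Complex.I, him, ← Complex.conj_mul' (w - φ.a), map_sub]
  field_simp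
  rw [← Complex.conj_mul']
  linear_combination (2 * φ.a - z - w) * hww

end DiscAut

section AffineConjugation

variable {φ : DiscAut} {w : ℂ} {A B : ℝ}

theorem re_cayley_iterate (h : ∀ z : 𝔻, cayley w (φ.map z) = A * cayley w z + B * Complex.I)
    (c : 𝔻) (n : ℕ) :
    (cayley w (φ.map^[n] c : 𝔻)).re = A ^ n * (cayley w c).re := by
  induction n with
  | zero => simp
  | succ n ih =>
    rw [Function.iterate_succ_apply', h, pow_succ', mul_assoc, ← ih]
    simp

theorem im_cayley_iterate (h : ∀ z : 𝔻, cayley w (φ.map z) = cayley w z + B * Complex.I)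
    (c : 𝔻) (n : ℕ) :
    (cayley w (φ.map^[n] c : 𝔻)).im = n * B + (cayley w c).im := by
  induction n with
  | zero => simp
  | succ n ih =>
    rw [Function.iterate_succ_apply', h, Complex.add_im, ih]
    simp
    ring

theorem summable_one_sub_norm_iterate_of_ne_one (hw : ‖w‖ = 1) (hA : 0 < A) (hA1 : A ≠ 1)
    (h : ∀ z : 𝔻, cayley w (φ.map z) = A * cayley w z + B * Complex.I) (c : 𝔻) :
    Summable fun n : ℕ => 1 - ‖(φ.map^[n] c : ℂ)‖ := by
  have hnn (n : ℕ) : 0 ≤ 1 - ‖(φ.map^[n] c : ℂ)‖ := sub_nonneg.2 (φ.map^[n] c).norm_lt_one.le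
  rcases hA1.lt_or_gt with hlt | hgt
  · refine Summable.of_nonneg_of_le hnn (fun n => one_sub_norm_le_four_mul_re_cayley hw _) ?_
    simp only [re_cayley_iterate h]
    exact ((summable_geometric_of_lt_one hA.le hlt).mul_right _).mul_left 4
  · refine Summable.of_nonneg_of_le hnn (fun n => one_sub_norm_le_four_mul_inv_re_cayley hw _) ?_
    simp only [re_cayley_iterate h, mul_inv, ← inv_pow]
    exact ((summable_geometric_of_lt_one (inv_nonneg.2 hA.le)
      (inv_lt_one_of_one_lt₀ hgt)).mul_right _).mul_left 4

theorem summable_one_sub_norm_iterate_of_translation (hw : ‖w‖ = 1) (hB : B ≠ 0)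
    (h : ∀ z : 𝔻, cayley w (φ.map z) = cayley w z + B * Complex.I) (c : 𝔻) :
    Summable fun n : ℕ => 1 - ‖(φ.map^[n] c : ℂ)‖ := by
  set β : ℝ := (cayley w c).im / B
  have him (n : ℕ) : (cayley w (φ.map^[n] c : 𝔻)).im = B * (n + β) := by
    rw [im_cayley_iterate h, mul_add, mul_div_cancel₀ _ hB, mul_comm]
  have hre (n : ℕ) : (cayley w (φ.map^[n] c : 𝔻)).re = (cayley w c).re := by
    simpa using re_cayley_iterate (A := 1) (by simpa using h) c n
  have hsum := (Real.summable_one_div_nat_add_rpow β 2).2 one_lt_two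
  refine Summable.of_norm_bounded_eventually_nat
    (hsum.mul_left (4 * (cayley w c).re / B ^ 2)) ?_
  filter_upwards [tendsto_natCast_atTop_atTop.eventually_gt_atTop (-β)] with n hn
  have hn0 : (n : ℝ) + β ≠ 0 := by linarith
  rw [Real.norm_of_nonneg (sub_nonneg.2 (φ.map^[n] c).norm_lt_one.le)]
  refine (one_sub_norm_le_four_mul_re_div_sq_im_cayley hw _
    (by rw [him]; exact mul_ne_zero hB hn0)).trans_eq ?_
  rw [hre, him, Real.rpow_two, sq_abs, mul_pow, mul_one_div, div_div]

end AffineConjugation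

namespace DiscAut

variable (φ : DiscAut)

theorem summable_one_sub_norm_iterate {w : ℂ} (hw : ‖w‖ = 1) (hfix : φ.eval w = w)
    (hne : ∃ z : 𝔻, φ.map z ≠ z) (c : 𝔻) :
    Summable fun n : ℕ => 1 - ‖(φ.map^[n] c : ℂ)‖ := by
  obtain ⟨A, B, hA, h⟩ := φ.exists_cayley_map hw hfix
  rcases ne_or_eq A 1 with hA1 | rfl
  · exact summable_one_sub_norm_iterate_of_ne_one hw hA hA1 h c
  simp only [Complex.ofReal_one, one_mul] at h
  refine summable_one_sub_norm_iterate_of_translation hw (fun hB : B = 0 => ?_) h c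
  obtain ⟨z, hz⟩ := hne
  exact hz (injective_cayley hw (by simp only [h, hB, Complex.ofReal_zero, zero_mul, add_zero]))

theorem exists_boundary_fixed_point (hφ : φ.IsParabolic ∨ φ.IsHyperbolic) :
    (∃ w : ℂ, ‖w‖ = 1 ∧ φ.eval w = w) ∧ ∃ z : 𝔻, φ.map z ≠ z := by
  rcases hφ with ⟨w, hw, hfix⟩ | ⟨hne, w, -, -, hw, -, hfix, -⟩
  · refine ⟨⟨w, hw, (hfix w hw.le).2 rfl⟩, 0, fun h0 => ?_⟩
    have hw0 : (0 : ℂ) = w := (hfix 0 (by simp)).1 (Complex.UnitDisc.coe_inj.2 h0)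
    exact ne_coe_of_norm_eq_one hw 0 hw0.symm
  · exact ⟨⟨w, hw, hfix⟩, hne⟩

end DiscAut

/-! ### Analytic functions on the disc -/

theorem zeroExt_of_lt (f : 𝔻 → ℂ) {z : ℂ} (hz : ‖z‖ < 1) :
    zeroExt f z = f (Complex.UnitDisc.mk z hz) := dif_pos hz

@[simp] theorem zeroExt_coe (f : 𝔻 → ℂ) (z : 𝔻) : zeroExt f z = f z := by
  rw [zeroExt_of_lt f z.norm_lt_one, Complex.UnitDisc.mk_coe]

theorem zeroExt_mul (f g : 𝔻 → ℂ) : zeroExt (f * g) = zeroExt f * zeroExt g := by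
  funext z
  simp only [zeroExt, Pi.mul_apply]
  split_ifs <;> simp

theorem isAnalytic_of_eq {f : 𝔻 → ℂ} {F : ℂ → ℂ} (hF : DifferentiableOn ℂ F (Metric.ball 0 1))
    (h : ∀ z : 𝔻, f z = F z) : IsAnalytic f :=
  hF.congr fun z hz => by rw [zeroExt_of_lt f (mem_ball_zero_iff.1 hz), h, Complex.UnitDisc.coe_mk]

theorem isAnalytic_const (c : ℂ) : IsAnalytic fun _ => c :=
  isAnalytic_of_eq (differentiableOn_const c) fun _ => rfl

theorem IsAnalytic.mul {f g : 𝔻 → ℂ} (hf : IsAnalytic f) (hg : IsAnalytic g) :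
    IsAnalytic (f * g) := by
  rw [IsAnalytic, zeroExt_mul]
  exact DifferentiableOn.mul hf hg

theorem DiscAut.isAnalytic_eval (φ : DiscAut) : IsAnalytic fun z : 𝔻 => φ.eval z :=
  isAnalytic_of_eq (φ.differentiableOn_eval.mono Metric.ball_subset_closedBall) fun _ => rfl

theorem IsAnalytic.comp_map {f : 𝔻 → ℂ} (hf : IsAnalytic f) (φ : DiscAut) :
    IsAnalytic (f ∘ φ.map) := by
  have hmaps : Set.MapsTo φ.eval (Metric.ball 0 1) (Metric.ball 0 1) := fun z hz =>
    mem_ball_zero_iff.2 (φ.norm_eval_lt_one z (mem_ball_zero_iff.1 hz))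
  refine isAnalytic_of_eq (F := zeroExt f ∘ φ.eval) (DifferentiableOn.comp hf
    (φ.differentiableOn_eval.mono Metric.ball_subset_closedBall) hmaps) fun z => ?_
  rw [Function.comp_apply, Function.comp_apply, ← DiscAut.coe_map, zeroExt_coe]

theorem isOpenEmbedding_coe_unitDisc : IsOpenEmbedding ((↑) : 𝔻 → ℂ) := by
  refine ⟨Complex.UnitDisc.isEmbedding_coe, ?_⟩
  have hrange : Set.range ((↑) : 𝔻 → ℂ) = Metric.ball 0 1 := Set.Subset.antisymm
    (Set.range_subset_iff.2 fun w => mem_ball_zero_iff.2 w.norm_lt_one)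
    fun z hz => ⟨Complex.UnitDisc.mk z (mem_ball_zero_iff.1 hz), rfl⟩
  rw [hrange]
  exact Metric.isOpen_ball

section LocallyUniformLimit

variable {ι : Type*} {l : Filter ι} {F : ι → 𝔻 → ℂ} {f : 𝔻 → ℂ}

theorem tendsto_of_tendstoLocallyUniformly (h : TendstoLocallyUniformly F f l) (z : 𝔻) :
    Tendsto (fun n => F n z) l (𝓝 (f z)) :=
  (tendstoLocallyUniformlyOn_univ.2 h).tendsto_at (Set.mem_univ z)

theorem tendstoLocallyUniformlyOn_zeroExt (h : TendstoLocallyUniformly F f l) :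
    TendstoLocallyUniformlyOn (fun n => zeroExt (F n)) (zeroExt f) l (Metric.ball 0 1) := by
  intro u hu x hx
  lift x to 𝔻 using mem_ball_zero_iff.1 hx
  obtain ⟨t, ht, ht'⟩ := h u hu x
  refine ⟨_, mem_nhdsWithin_of_mem_nhds (isOpenEmbedding_coe_unitDisc.image_mem_nhds.2 ht), ?_⟩
  filter_upwards [ht'] with n hn
  rintro _ ⟨z, hz, rfl⟩
  simpa only [zeroExt_coe] using hn z hz

theorem isAnalytic_of_tendstoLocallyUniformly [l.NeBot] (hF : ∀ n, IsAnalytic (F n))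
    (h : TendstoLocallyUniformly F f l) : IsAnalytic f :=
  (tendstoLocallyUniformlyOn_zeroExt h).differentiableOn (Eventually.of_forall hF)
    Metric.isOpen_ball

end LocallyUniformLimit

theorem IsAnalytic.eq_zero_of_tendsto {f : 𝔻 → ℂ} (hf : IsAnalytic f) {c : ℕ → 𝔻}
    (hc : Tendsto (fun k => (c k : ℂ)) atTop (𝓝[≠] 0)) (h : ∀ k, f (c k) = 0) : f = 0 := by
  have hfreq : ∃ᶠ z in 𝓝[≠] (0 : ℂ), zeroExt f z = 0 :=
    hc.frequently (Frequently.of_forall fun k => by rw [zeroExt_coe, h])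
  have hzero := (DifferentiableOn.analyticOnNhd hf
    Metric.isOpen_ball).eqOn_zero_of_preconnected_of_frequently_eq_zero
      (convex_ball (0 : ℂ) 1).isPreconnected (Metric.mem_ball_self one_pos) hfreq
  funext z
  rw [← zeroExt_coe f z]
  exact hzero (mem_ball_zero_iff.2 z.norm_lt_one)

/-! ### Schur functions and their infinite products -/

/-- A Schur function: an analytic function on the disc bounded by one. -/
structure IsSchur (f : 𝔻 → ℂ) : Prop where
  isAnalytic : IsAnalytic f
  norm_le_one : ∀ z, ‖f z‖ ≤ 1

namespace IsSchur

theorem mul {f g : 𝔻 → ℂ} (hf : IsSchur f) (hg : IsSchur g) : IsSchur (f * g) where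
  isAnalytic := hf.isAnalytic.mul hg.isAnalytic
  norm_le_one z := by
    rw [Pi.mul_apply, norm_mul]
    exact mul_le_one₀ (hf.norm_le_one z) (norm_nonneg _) (hg.norm_le_one z)

theorem const {c : ℂ} (hc : ‖c‖ ≤ 1) : IsSchur fun _ => c := ⟨isAnalytic_const c, fun _ => hc⟩

theorem prod {ι : Type*} {g : ι → 𝔻 → ℂ} (hg : ∀ i, IsSchur (g i)) (s : Finset ι) :
    IsSchur fun z => ∏ i ∈ s, g i z := by
  classical
  induction s using Finset.induction_on with
  | empty => simpa only [Finset.prod_empty] using const norm_one.le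
  | insert i s hi ih => simp only [Finset.prod_insert hi]; exact (hg i).mul ih

theorem comp_map {f : 𝔻 → ℂ} (hf : IsSchur f) (φ : DiscAut) : IsSchur (f ∘ φ.map) :=
  ⟨hf.isAnalytic.comp_map φ, fun z => hf.norm_le_one (φ.map z)⟩

theorem comp_iterate_map {f : 𝔻 → ℂ} (hf : IsSchur f) (φ : DiscAut) (n : ℕ) :
    IsSchur (f ∘ φ.map^[n]) := by
  induction n with
  | zero => exact hf
  | succ n ih => rw [Function.iterate_succ, ← Function.comp_assoc]; exact ih.comp_map φ

theorem of_tendstoLocallyUniformly {ι : Type*} {l : Filter ι} [l.NeBot] {F : ι → 𝔻 → ℂ}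
    {f : 𝔻 → ℂ} (hF : ∀ n, IsSchur (F n)) (h : TendstoLocallyUniformly F f l) : IsSchur f where
  isAnalytic := isAnalytic_of_tendstoLocallyUniformly (fun n => (hF n).isAnalytic) h
  norm_le_one z := le_of_tendsto (tendsto_of_tendstoLocallyUniformly h z).norm
    (Eventually.of_forall fun n => (hF n).norm_le_one z)

/-- Borel–Carathéodory for `f - f 0`, whose real part is at most `1 - f 0`. -/
theorem norm_sub_apply_zero_le {f : 𝔻 → ℂ} (hf : IsSchur f) (h0 : f 0 = ‖f 0‖) (z : 𝔻) :
    ‖f z - f 0‖ ≤ 2 * (1 - ‖f 0‖) * ‖(z : ℂ)‖ / (1 - ‖(z : ℂ)‖) := by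
  have hlt (M : ℝ) (hM : 1 - ‖f 0‖ < M) :
      ‖f z - f 0‖ ≤ 2 * M * ‖(z : ℂ)‖ / (1 - ‖(z : ℂ)‖) := by
    have hre : Set.MapsTo (fun y => zeroExt f y - f 0) (Metric.ball 0 1) {y | y.re ≤ M} := by
      intro y hy
      lift y to 𝔻 using mem_ball_zero_iff.1 hy
      have hy := (Complex.re_le_norm (f y)).trans (hf.norm_le_one y)
      change (zeroExt f y - f 0).re ≤ M
      rw [zeroExt_coe, h0, Complex.sub_re, Complex.ofReal_re]
      linarith
    have h := Complex.borelCaratheodory_zero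
      ((sub_nonneg.2 (hf.norm_le_one 0)).trans_lt hM) (DifferentiableOn.sub_const hf.isAnalytic _)
      hre one_pos (mem_ball_zero_iff.2 z.norm_lt_one)
      (sub_eq_zero.2 (zeroExt_coe f 0))
    rwa [zeroExt_coe] at h
  have hcont : Continuous fun M : ℝ => 2 * M * ‖(z : ℂ)‖ / (1 - ‖(z : ℂ)‖) := by fun_prop
  exact ge_of_tendsto ((hcont.tendsto (1 - ‖f 0‖)).mono_left nhdsWithin_le_nhds)
    (eventually_nhdsWithin_of_forall (s := Set.Ioi (1 - ‖f 0‖)) hlt)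

theorem norm_sub_one_le {f : 𝔻 → ℂ} (hf : IsSchur f) (h0 : f 0 = ‖f 0‖) (z : 𝔻) :
    ‖f z - 1‖ ≤ (1 - ‖f 0‖) * ((1 + ‖(z : ℂ)‖) / (1 - ‖(z : ℂ)‖)) := by
  have hz : 0 < 1 - ‖(z : ℂ)‖ := sub_pos.2 z.norm_lt_one
  have h01 : ‖f 0 - 1‖ = 1 - ‖f 0‖ := by
    rw [h0, Complex.norm_real, norm_norm, ← Complex.ofReal_one, ← Complex.ofReal_sub,
      Complex.norm_real, norm_sub_rev, Real.norm_of_nonneg (sub_nonneg.2 (hf.norm_le_one 0))]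
  calc ‖f z - 1‖ ≤ ‖f z - f 0‖ + ‖f 0 - 1‖ := norm_sub_le_norm_sub_add_norm_sub _ _ _
    _ ≤ 2 * (1 - ‖f 0‖) * ‖(z : ℂ)‖ / (1 - ‖(z : ℂ)‖) + (1 - ‖f 0‖) :=
      add_le_add (hf.norm_sub_apply_zero_le h0 z) h01.le
    _ = (1 - ‖f 0‖) * ((1 + ‖(z : ℂ)‖) / (1 - ‖(z : ℂ)‖)) := by field_simp; ring

end IsSchur

theorem DiscAut.isSchur_eval (φ : DiscAut) : IsSchur fun z : 𝔻 => φ.eval z :=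
  ⟨φ.isAnalytic_eval, fun z => φ.norm_eval_le_one z.norm_lt_one.le⟩

theorem one_sub_sum_one_sub_le_prod {ι : Type*} (s : Finset ι) {x : ι → ℝ} (h0 : ∀ i, 0 ≤ x i)
    (h1 : ∀ i, x i ≤ 1) : 1 - ∑ i ∈ s, (1 - x i) ≤ ∏ i ∈ s, x i := by
  classical
  induction s using Finset.induction_on with
  | empty => simp
  | insert a s ha ih =>
    rw [Finset.sum_insert ha, Finset.prod_insert ha]
    have hprod : ∏ i ∈ s, x i ≤ 1 := Finset.prod_le_one (fun i _ => h0 i) fun i _ => h1 i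
    nlinarith [mul_nonneg (sub_nonneg.2 (h1 a)) (sub_nonneg.2 hprod)]

theorem exists_circle_mul_eq_norm (c : ℂ) : ∃ u : Circle, (u : ℂ) * c = ‖(u : ℂ) * c‖ := by
  refine ⟨Circle.exp (-c.arg), ?_⟩
  rw [norm_mul, Circle.norm_coe, one_mul]
  nth_rewrite 2 [← Complex.norm_mul_exp_arg_mul_I c]
  rw [Circle.coe_exp, mul_left_comm, ← Complex.exp_add, Complex.ofReal_neg, neg_mul,
    neg_add_cancel, Complex.exp_zero, mul_one]

/-- A sequence of Schur functions `g j` satisfying the Blaschke condition `∑ (1 - |g j 0|) < ∞` and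
normalized by `g j 0 ≥ 0`; this makes its infinite product converge. -/
structure IsNormalizedFamily (g : ℕ → 𝔻 → ℂ) : Prop where
  isSchur : ∀ j, IsSchur (g j)
  apply_zero : ∀ j, g j 0 = ‖g j 0‖
  summable : Summable fun j => 1 - ‖g j 0‖

theorem exists_isNormalizedFamily {h : ℕ → 𝔻 → ℂ} (hh : ∀ j, IsSchur (h j))
    (hsum : Summable fun j => 1 - ‖h j 0‖) :
    ∃ u : ℕ → Circle, IsNormalizedFamily fun j z => u j * h j z := by
  choose u hu using fun j => exists_circle_mul_eq_norm (h j 0)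
  refine ⟨u, fun j => (IsSchur.const (Circle.norm_coe (u j)).le).mul (hh j), hu, ?_⟩
  simpa only [norm_mul, Circle.norm_coe, one_mul] using hsum

namespace IsNormalizedFamily

variable {g : ℕ → 𝔻 → ℂ} (hg : IsNormalizedFamily g)
include hg

theorem shift (n : ℕ) : IsNormalizedFamily fun j => g (j + n) :=
  ⟨fun j => hg.isSchur (j + n), fun j => hg.apply_zero (j + n),
    (summable_nat_add_iff (f := fun j => 1 - ‖g j 0‖) n).2 hg.summable⟩

theorem norm_prod_sub_one_le (s : Finset ℕ) (z : 𝔻) :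
    ‖∏ j ∈ s, g j z - 1‖ ≤
      (∑ j ∈ s, (1 - ‖g j 0‖)) * ((1 + ‖(z : ℂ)‖) / (1 - ‖(z : ℂ)‖)) := by
  have h0 : ∏ j ∈ s, g j 0 = ‖∏ j ∈ s, g j 0‖ := by
    rw [norm_prod, Complex.ofReal_prod]
    exact Finset.prod_congr rfl fun j _ => hg.apply_zero j
  have hz : 0 ≤ (1 + ‖(z : ℂ)‖) / (1 - ‖(z : ℂ)‖) :=
    div_nonneg (by positivity) (sub_nonneg.2 z.norm_lt_one.le)
  refine ((IsSchur.prod hg.isSchur s).norm_sub_one_le h0 z).trans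
    (mul_le_mul_of_nonneg_right ?_ hz)
  rw [norm_prod, sub_le_comm]
  exact one_sub_sum_one_sub_le_prod s (fun j => norm_nonneg _) fun j => (hg.isSchur j).norm_le_one 0

theorem multipliable (z : 𝔻) : Multipliable fun j => g j z := by
  have hle (j : ℕ) : ‖g j z - 1‖ ≤ (1 - ‖g j 0‖) * ((1 + ‖(z : ℂ)‖) / (1 - ‖(z : ℂ)‖)) := by
    simpa only [Finset.prod_singleton, Finset.sum_singleton] using
      hg.norm_prod_sub_one_le {j} z
  have hsum : Summable fun j => ‖g j z - 1‖ :=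
    Summable.of_nonneg_of_le (fun _ => norm_nonneg _) hle (hg.summable.mul_right _)
  simpa only [add_sub_cancel] using multipliable_one_add_of_summable hsum

theorem norm_tprod_sub_one_le (z : 𝔻) :
    ‖∏' j, g j z - 1‖ ≤
      (∑' j, (1 - ‖g j 0‖)) * ((1 + ‖(z : ℂ)‖) / (1 - ‖(z : ℂ)‖)) :=
  le_of_tendsto_of_tendsto ((hg.multipliable z).hasProd.sub_const 1).norm
    (hg.summable.hasSum.mul_const _)
    (Eventually.of_forall fun s => hg.norm_prod_sub_one_le s z)

theorem prod_mul_tprod_shift (n : ℕ) (z : 𝔻) :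
    (∏ j ∈ Finset.range n, g j z) * ∏' j, g (j + n) z = ∏' j, g j z :=
  ((hg.shift n).multipliable z).prod_mul_tprod_nat_mul'

theorem tendsto_tprod_shift (z : 𝔻) :
    Tendsto (fun n => ∏' j, g (j + n) z) atTop (𝓝 1) := by
  rw [tendsto_iff_norm_sub_tendsto_zero]
  refine squeeze_zero (fun _ => norm_nonneg _) (fun n => (hg.shift n).norm_tprod_sub_one_le z) ?_
  simpa only [zero_mul] using (tendsto_sum_nat_add fun j => 1 - ‖g j 0‖).mul_const _

theorem tendstoLocallyUniformly_prod :
    TendstoLocallyUniformly (fun n z => ∏ j ∈ Finset.range n, g j z) (fun z => ∏' j, g j z)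
      atTop := by
  rw [Metric.tendstoLocallyUniformly_iff]
  intro ε hε x
  obtain ⟨r, hxr, hr⟩ := exists_between x.norm_lt_one
  have htail : Tendsto (fun n => (∑' j, (1 - ‖g (j + n) 0‖)) * ((1 + r) / (1 - r))) atTop
      (𝓝 0) := by
    simpa only [zero_mul] using (tendsto_sum_nat_add fun j => 1 - ‖g j 0‖).mul_const _
  refine ⟨{z | ‖(z : ℂ)‖ < r}, (isOpen_lt Complex.UnitDisc.continuous_coe.norm
    continuous_const).mem_nhds hxr, ?_⟩
  filter_upwards [htail.eventually_lt_const hε] with n hn z hz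
  have hz : ‖(z : ℂ)‖ < r := hz
  have hr0 : 0 ≤ r := (norm_nonneg _).trans hz.le
  have : 0 < 1 - r := sub_pos.2 hr
  calc dist (∏' j, g j z) (∏ j ∈ Finset.range n, g j z)
      = ‖∏ j ∈ Finset.range n, g j z‖ * ‖∏' j, g (j + n) z - 1‖ := by
        rw [dist_eq_norm, ← hg.prod_mul_tprod_shift n z, ← norm_mul, mul_sub_one]
    _ ≤ ‖∏' j, g (j + n) z - 1‖ :=
        mul_le_of_le_one_left (norm_nonneg _) ((IsSchur.prod hg.isSchur _).norm_le_one z)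
    _ ≤ (∑' j, (1 - ‖g (j + n) 0‖)) * ((1 + ‖(z : ℂ)‖) / (1 - ‖(z : ℂ)‖)) :=
        (hg.shift n).norm_tprod_sub_one_le z
    _ ≤ (∑' j, (1 - ‖g (j + n) 0‖)) * ((1 + r) / (1 - r)) := by
        have h0 : 0 ≤ ∑' j, (1 - ‖g (j + n) 0‖) :=
          tsum_nonneg fun j => sub_nonneg.2 ((hg.isSchur (j + n)).norm_le_one 0)
        gcongr
    _ < ε := hn

theorem isSchur_tprod : IsSchur fun z => ∏' j, g j z :=
  IsSchur.of_tendstoLocallyUniformly (fun _ => IsSchur.prod hg.isSchur _)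
    hg.tendstoLocallyUniformly_prod

end IsNormalizedFamily

/-! ### Poisson integrals and means of analytic functions -/

theorem tangent_le_rpow {p : ℝ} (hp : 1 ≤ p) {x t : ℝ} (hx : 0 ≤ x) (ht : 0 ≤ t) :
    x ^ p + p * x ^ (p - 1) * (t - x) ≤ t ^ p := by
  rcases hx.eq_or_lt with rfl | hx
  · rcases hp.eq_or_lt with rfl | hp
    · simp
    · rw [Real.zero_rpow (by linarith), Real.zero_rpow (by linarith), mul_zero, zero_mul, add_zero]
      positivity
  · have h := one_add_mul_self_le_rpow_one_add (s := t / x - 1) (p := p)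
      (by linarith [div_nonneg ht hx.le]) hp
    rw [add_sub_cancel, Real.div_rpow ht hx.le, le_div_iff₀ (by positivity)] at h
    refine le_of_eq_of_le ?_ h
    rw [Real.rpow_sub_one hx.ne']
    field_simp

section Poisson

variable {c w : ℂ} {R : ℝ}

theorem continuousOn_poissonKernel (hw : w ∈ Metric.ball c R) :
    ContinuousOn (poissonKernel c w) (Metric.sphere c R) := by
  simp only [funext (poissonKernel_def c w)]
  refine ContinuousOn.div (by fun_prop) (by fun_prop) fun z hz => ?_
  have hzw : z ≠ w := fun h => (Metric.mem_ball.1 hw).ne (h ▸ Metric.mem_sphere.1 hz)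
  simpa [sub_eq_zero] using hzw

theorem poissonKernel_nonneg (hw : w ∈ Metric.ball c R) {z : ℂ} (hz : z ∈ Metric.sphere c R) :
    0 ≤ poissonKernel c w z := by
  rw [poissonKernel_def, mem_sphere_iff_norm.1 hz]
  have hle : ‖w - c‖ ^ 2 ≤ R ^ 2 := by
    gcongr
    exact (mem_ball_iff_norm.1 hw).le
  exact div_nonneg (sub_nonneg.2 hle) (by positivity)

theorem circleAverage_poissonKernel (hw : w ∈ Metric.ball c R) :
    circleAverage (poissonKernel c w) c R = 1 := by
  have h := (InnerProductSpace.harmonicContOnCl_const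
    (c := (1 : ℝ))).circleAverage_poissonKernel_smul hw
  have hone : poissonKernel c w • (fun _ => (1 : ℝ)) = poissonKernel c w := mul_one _
  rwa [hone] at h

theorem norm_circleAverage_le {E : Type*} [NormedAddCommGroup E] [NormedSpace ℝ E] (f : ℂ → E) :
    ‖circleAverage f c R‖ ≤ circleAverage (fun z => ‖f z‖) c R := by
  have h2π : 0 ≤ (2 * π)⁻¹ := by positivity
  rw [circleAverage_def, circleAverage_def, norm_smul, smul_eq_mul, Real.norm_of_nonneg h2π]
  exact mul_le_mul_of_nonneg_left
    (intervalIntegral.norm_integral_le_integral_norm two_pi_pos.le) h2π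

theorem norm_le_circleAverage {g : ℂ → ℂ} (hg : DiffContOnCl ℂ g (Metric.ball c R))
    (hw : w ∈ Metric.ball c R) :
    ‖g w‖ ≤ circleAverage (fun z => poissonKernel c w z * ‖g z‖) c R := by
  rw [← hg.circleAverage_poissonKernel_smul hw]
  refine (norm_circleAverage_le _).trans_eq (circleAverage_congr_sphere fun z hz => ?_)
  rw [abs_of_pos (Metric.pos_of_mem_ball hw)] at hz
  rw [Pi.smul_apply', norm_smul, Real.norm_of_nonneg (poissonKernel_nonneg hw hz)]

/-- Jensen's inequality for the Poisson measure: integrate the tangent line at the mean value. -/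
theorem rpow_circleAverage_le {p : ℝ} (hp : 1 ≤ p) (hw : w ∈ Metric.ball c R) {u : ℂ → ℝ}
    (hu : ContinuousOn u (Metric.sphere c R)) (hu0 : ∀ z ∈ Metric.sphere c R, 0 ≤ u z) :
    circleAverage (fun z => poissonKernel c w z * u z) c R ^ p ≤
      circleAverage (fun z => poissonKernel c w z * u z ^ p) c R := by
  have hR : 0 < R := Metric.pos_of_mem_ball hw
  have hP := continuousOn_poissonKernel hw
  have hPu : CircleIntegrable (fun z => poissonKernel c w z * u z) c R :=
    (hP.mul hu).circleIntegrable hR.le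
  set x := circleAverage (fun z => poissonKernel c w z * u z) c R with hx
  have hx0 : 0 ≤ x := circleAverage_nonneg_of_nonneg fun z hz =>
    mul_nonneg (poissonKernel_nonneg hw (abs_of_pos hR ▸ hz)) (hu0 z (abs_of_pos hR ▸ hz))
  set k := p * x ^ (p - 1)
  calc x ^ p
      = circleAverage ((x ^ p - k * x) • poissonKernel c w +
          k • fun z => poissonKernel c w z * u z) c R := by
        rw [circleAverage_add (hP.circleIntegrable hR.le).const_smul hPu.const_smul,
          circleAverage_smul, circleAverage_smul, circleAverage_poissonKernel hw, ← hx,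
          smul_eq_mul, smul_eq_mul]
        ring
    _ ≤ circleAverage (fun z => poissonKernel c w z * u z ^ p) c R := by
        refine circleAverage_mono
          ((hP.circleIntegrable hR.le).const_smul.add hPu.const_smul)
          ((hP.mul (hu.rpow_const fun _ _ => Or.inr (by linarith))).circleIntegrable hR.le)
          fun z hz => ?_
        have h := mul_le_mul_of_nonneg_left (tangent_le_rpow hp hx0 (hu0 z (abs_of_pos hR ▸ hz)))
          (poissonKernel_nonneg hw (abs_of_pos hR ▸ hz))
        refine le_of_eq_of_le ?_ h
        simp only [Pi.add_apply, Pi.smul_apply, smul_eq_mul]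
        ring

theorem rpow_norm_le_circleAverage {p : ℝ} (hp : 1 ≤ p) {g : ℂ → ℂ}
    (hg : DiffContOnCl ℂ g (Metric.ball c R)) (hw : w ∈ Metric.ball c R) :
    ‖g w‖ ^ p ≤ circleAverage (fun z => poissonKernel c w z * ‖g z‖ ^ p) c R :=
  (Real.rpow_le_rpow (norm_nonneg _) (norm_le_circleAverage hg hw) (by linarith)).trans
    (rpow_circleAverage_le hp hw (hg.continuousOn_ball.mono Metric.sphere_subset_closedBall).norm
      fun z _ => norm_nonneg (g z))

end Poisson

section IteratedAverage

variable {F : ℂ → ℂ → ℝ} {c d : ℂ} {R S : ℝ}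

theorem continuous_circleMap_prod (hR : 0 ≤ R) (hS : 0 ≤ S)
    (hF : ContinuousOn (Function.uncurry F) (Metric.sphere c R ×ˢ Metric.sphere d S)) :
    Continuous (Function.uncurry fun s t => F (circleMap c R s) (circleMap d S t)) :=
  hF.comp_continuous (f := fun q : ℝ × ℝ => (circleMap c R q.1, circleMap d S q.2)) (by fun_prop)
    fun q => ⟨circleMap_mem_sphere c hR q.1, circleMap_mem_sphere d hS q.2⟩

theorem circleIntegrable_circleAverage (hR : 0 ≤ R) (hS : 0 ≤ S)
    (hF : ContinuousOn (Function.uncurry F) (Metric.sphere c R ×ˢ Metric.sphere d S)) :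
    CircleIntegrable (fun u => circleAverage (F u) d S) c R := by
  have h := intervalIntegral.continuous_parametric_intervalIntegral_of_continuous'
    (μ := MeasureTheory.volume) (continuous_circleMap_prod hR hS hF) 0 (2 * π)
  exact (h.const_smul (2 * π)⁻¹).intervalIntegrable 0 (2 * π)

theorem circleAverage_comm (hR : 0 ≤ R) (hS : 0 ≤ S)
    (hF : ContinuousOn (Function.uncurry F) (Metric.sphere c R ×ˢ Metric.sphere d S)) :
    circleAverage (fun u => circleAverage (F u) d S) c R =
      circleAverage (fun z => circleAverage (fun u => F u z) c R) d S := by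
  have hint : MeasureTheory.IntegrableOn
      (Function.uncurry fun s t => F (circleMap c R s) (circleMap d S t))
      (Set.uIoc 0 (2 * π) ×ˢ Set.uIoc 0 (2 * π)) :=
    ((continuous_circleMap_prod hR hS hF).continuousOn.integrableOn_compact
      (isCompact_uIcc.prod isCompact_uIcc)).mono_set
      (Set.prod_mono Set.uIoc_subset_uIcc Set.uIoc_subset_uIcc)
  simp only [circleAverage_def, intervalIntegral.integral_smul]
  rw [MeasureTheory.intervalIntegral_intervalIntegral_swap hint]

end IteratedAverage

theorem circleAverage_mul_left {R : ℝ} (f : ℂ → ℝ) {z : ℂ} (hz : z ∈ Metric.sphere (0 : ℂ) R) :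
    circleAverage (fun u => f (u * z)) 0 1 = circleAverage f 0 R := by
  obtain ⟨η, rfl⟩ : ∃ η, circleMap 0 R η = z := ⟨z.arg, by
    rw [circleMap_zero, ← mem_sphere_zero_iff_norm.1 hz, Complex.norm_mul_exp_arg_mul_I]⟩
  rw [circleAverage_def, circleAverage_eq_integral_add η]
  congr 1
  refine intervalIntegral.integral_congr fun θ _ => congrArg f ?_
  simp only [circleMap_zero, Complex.ofReal_add, add_mul, Complex.exp_add, Complex.ofReal_one]
  ring

theorem diffContOnCl_comp_mul_left {g : ℂ → ℂ} {R : ℝ}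
    (hg : DiffContOnCl ℂ g (Metric.ball 0 R)) {u : ℂ} (hu : u ∈ Metric.sphere (0 : ℂ) 1) :
    DiffContOnCl ℂ (fun z => g (u * z)) (Metric.ball 0 R) :=
  hg.comp (differentiable_id.const_mul u).diffContOnCl fun z hz => by
    rw [mem_ball_zero_iff] at *
    rwa [norm_mul, mem_sphere_zero_iff_norm.1 hu, one_mul]

theorem continuousOn_rpow_norm_mul {p : ℝ} (hp : 0 ≤ p) {g : ℂ → ℂ} {R : ℝ}
    (hg : ContinuousOn g (Metric.sphere 0 R)) :
    ContinuousOn (fun q : ℂ × ℂ => ‖g (q.1 * q.2)‖ ^ p)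
      (Metric.sphere (0 : ℂ) 1 ×ˢ Metric.sphere (0 : ℂ) R) := by
  refine ContinuousOn.rpow_const (hg.comp (by fun_prop) fun q hq => ?_).norm fun _ _ => Or.inr hp
  rw [mem_sphere_zero_iff_norm, norm_mul, mem_sphere_zero_iff_norm.1 hq.1, one_mul]
  exact mem_sphere_zero_iff_norm.1 hq.2

/-- Apply the pointwise bound at `r` to all rotations of `g` and average over the rotations. -/
theorem circleAverage_rpow_norm_mono {p : ℝ} (hp : 1 ≤ p) {g : ℂ → ℂ} {r R : ℝ} (hr : 0 < r)
    (hrR : r < R) (hg : DiffContOnCl ℂ g (Metric.ball 0 R)) :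
    circleAverage (fun z => ‖g z‖ ^ p) 0 r ≤ circleAverage (fun z => ‖g z‖ ^ p) 0 R := by
  have hp0 : 0 ≤ p := zero_le_one.trans hp
  have hR : 0 < R := hr.trans hrR
  have hrR' : (r : ℂ) ∈ Metric.ball (0 : ℂ) R := by
    rwa [mem_ball_zero_iff, Complex.norm_of_nonneg hr.le]
  have hr' : (r : ℂ) ∈ Metric.sphere (0 : ℂ) r := by
    rw [mem_sphere_zero_iff_norm, Complex.norm_of_nonneg hr.le]
  have hg' {s : ℝ} (hs : s ≤ R) : ContinuousOn g (Metric.sphere 0 s) :=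
    hg.continuousOn_ball.mono
      (Metric.sphere_subset_closedBall.trans (Metric.closedBall_subset_closedBall hs))
  have hF : ContinuousOn
      (Function.uncurry fun u z => poissonKernel 0 (r : ℂ) z * ‖g (u * z)‖ ^ p)
      (Metric.sphere (0 : ℂ) 1 ×ˢ Metric.sphere (0 : ℂ) R) :=
    ((continuousOn_poissonKernel hrR').comp continuousOn_snd fun q hq => hq.2).mul
      (continuousOn_rpow_norm_mul hp0 (hg' le_rfl))
  calc circleAverage (fun z => ‖g z‖ ^ p) 0 r
      = circleAverage (fun u => ‖g (u * r)‖ ^ p) 0 1 :=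
        (circleAverage_mul_left (fun z => ‖g z‖ ^ p) hr').symm
    _ ≤ circleAverage (fun u => circleAverage
          (fun z => poissonKernel 0 (r : ℂ) z * ‖g (u * z)‖ ^ p) 0 R) 0 1 := by
        refine circleAverage_mono ?_ (circleIntegrable_circleAverage zero_le_one hR.le hF)
          fun u hu => rpow_norm_le_circleAverage hp
            (diffContOnCl_comp_mul_left hg (abs_one (α := ℝ) ▸ hu)) hrR'
        exact ((continuousOn_rpow_norm_mul hp0 (hg' hrR.le)).comp (f := fun u => (u, (r : ℂ)))
          (by fun_prop) fun u hu => ⟨hu, hr'⟩).circleIntegrable zero_le_one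
    _ = circleAverage (fun z => circleAverage
          (fun u => poissonKernel 0 (r : ℂ) z * ‖g (u * z)‖ ^ p) 0 1) 0 R :=
        circleAverage_comm zero_le_one hR.le hF
    _ = circleAverage (circleAverage (fun z => ‖g z‖ ^ p) 0 R • poissonKernel 0 (r : ℂ)) 0 R := by
        refine circleAverage_congr_sphere fun z hz => ?_
        simp only [← smul_eq_mul (poissonKernel 0 (r : ℂ) z), circleAverage_fun_smul]
        rw [circleAverage_mul_left (fun z => ‖g z‖ ^ p) (abs_of_pos hR ▸ hz), Pi.smul_apply,
          smul_eq_mul, smul_eq_mul, mul_comm]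
    _ = circleAverage (fun z => ‖g z‖ ^ p) 0 R := by
        rw [circleAverage_smul, circleAverage_poissonKernel hrR', smul_eq_mul, mul_one]

namespace DiscAut

variable (φ : DiscAut)

theorem mul_deriv_eval {z : ℂ} (hz : ‖z‖ = 1) :
    z * deriv φ.eval z = poissonKernel 0 φ.a z * φ.eval z := by
  have hden : 1 - conj (φ.a : ℂ) * z = z * conj (z - φ.a) := by
    rw [map_sub, mul_sub, Complex.mul_conj', hz]
    push_cast
    ring
  have hne := φ.den_ne_zero hz.le
  rw [(φ.hasDerivAt_eval hz.le).deriv, poissonKernel_def, eval, sub_zero, sub_zero, hz]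
  push_cast
  rw [← Complex.conj_mul' (z - φ.a)]
  rw [hden] at hne ⊢
  have hz0 := left_ne_zero_of_mul hne
  have hconj := right_ne_zero_of_mul hne
  have hza : z - φ.a ≠ 0 := sub_ne_zero.2 (ne_coe_of_norm_eq_one hz _)
  field_simp

/-- The lift of `φ` on the unit circle to the angular coordinate; its derivative is the Poisson
kernel at the zero of `φ`. -/
noncomputable def boundaryLift (t : ℝ) : ℝ :=
  (φ.eval 1).arg + ∫ s in (0 : ℝ)..t, poissonKernel 0 φ.a (circleMap 0 1 s)

theorem a_mem_ball : (φ.a : ℂ) ∈ Metric.ball (0 : ℂ) 1 := mem_ball_zero_iff.2 φ.a.norm_lt_one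

theorem continuous_poissonKernel_circleMap :
    Continuous fun t => poissonKernel 0 φ.a (circleMap 0 1 t) :=
  (continuousOn_poissonKernel φ.a_mem_ball).comp_continuous (continuous_circleMap 0 1)
    (circleMap_mem_sphere 0 zero_le_one)

theorem hasDerivAt_boundaryLift (t : ℝ) :
    HasDerivAt φ.boundaryLift (poissonKernel 0 φ.a (circleMap 0 1 t)) t :=
  (φ.continuous_poissonKernel_circleMap.integral_hasStrictDerivAt 0 t).hasDerivAt.const_add _

theorem boundaryLift_two_pi : φ.boundaryLift (2 * π) = φ.boundaryLift 0 + 2 * π := by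
  have h := circleAverage_poissonKernel φ.a_mem_ball
  rw [circleAverage_def, smul_eq_mul, inv_mul_eq_one₀ (by positivity)] at h
  rw [boundaryLift, boundaryLift, intervalIntegral.integral_same, add_zero, ← h]

theorem circleMap_boundaryLift_zero : circleMap 0 1 (φ.boundaryLift 0) = φ.eval 1 := by
  rw [boundaryLift, intervalIntegral.integral_same, add_zero, circleMap_zero]
  conv_rhs => rw [← Complex.norm_mul_exp_arg_mul_I (φ.eval 1)]
  rw [φ.norm_eval_eq_one norm_one]

theorem eval_circleMap (t : ℝ) : φ.eval (circleMap 0 1 t) = circleMap 0 1 (φ.boundaryLift t) := by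
  have hne (t : ℝ) : circleMap 0 1 (φ.boundaryLift t) ≠ 0 := circleMap_ne_center one_ne_zero
  have hderiv (t : ℝ) : HasDerivAt
      (fun t => φ.eval (circleMap 0 1 t) / circleMap 0 1 (φ.boundaryLift t)) 0 t := by
    have hz : ‖circleMap 0 1 t‖ = 1 := by rw [norm_circleMap_zero, abs_one]
    have hnum := (φ.hasDerivAt_eval hz.le).differentiableAt.hasDerivAt.comp t
      (hasDerivAt_circleMap 0 1 t)
    have hden := (hasDerivAt_circleMap 0 1 _).scomp t (φ.hasDerivAt_boundaryLift t)
    refine (hnum.div hden (hne t)).congr_deriv ?_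
    rw [div_eq_zero_iff, Function.comp_apply, Function.comp_apply, Complex.real_smul]
    refine Or.inl ?_
    linear_combination (circleMap 0 1 (φ.boundaryLift t) * Complex.I) * φ.mul_deriv_eval hz
  have hconst := is_const_of_deriv_eq_zero (fun t => (hderiv t).differentiableAt)
    (fun t => (hderiv t).deriv) t 0
  have hone : circleMap 0 1 0 = 1 := by simp [circleMap]
  rwa [hone, ← circleMap_boundaryLift_zero, div_self (hne 0), div_eq_one_iff_eq (hne t)] at hconst

theorem circleAverage_poissonKernel_mul_comp_eval {G : ℂ → ℝ}
    (hG : ContinuousOn G (Metric.sphere 0 1)) :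
    circleAverage (fun z => poissonKernel 0 φ.a z * G (φ.eval z)) 0 1 = circleAverage G 0 1 := by
  have hGc : Continuous fun t => G (circleMap 0 1 t) :=
    hG.comp_continuous (continuous_circleMap 0 1) (circleMap_mem_sphere 0 zero_le_one)
  have hper : Function.Periodic (fun t => G (circleMap 0 1 t)) (2 * π) := fun t => by
    simp only [periodic_circleMap 0 1 t]
  rw [circleAverage_def, circleAverage_def]
  congr 1
  calc ∫ t in (0 : ℝ)..2 * π,
        poissonKernel 0 φ.a (circleMap 0 1 t) * G (φ.eval (circleMap 0 1 t))
      = ∫ t in (0 : ℝ)..2 * π, G (circleMap 0 1 (φ.boundaryLift t)) *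
          poissonKernel 0 φ.a (circleMap 0 1 t) := by simp only [eval_circleMap, mul_comm]
    _ = ∫ t in φ.boundaryLift 0..φ.boundaryLift (2 * π), G (circleMap 0 1 t) :=
        intervalIntegral.integral_comp_mul_deriv (fun t _ => φ.hasDerivAt_boundaryLift t)
          φ.continuous_poissonKernel_circleMap.continuousOn hGc
    _ = ∫ t in (0 : ℝ)..2 * π, G (circleMap 0 1 t) := by
        rw [boundaryLift_two_pi, hper.intervalIntegral_add_eq _ 0, zero_add]

end DiscAut

/-! ### Elementary properties of Hardy spaces -/

open MeasureTheory in
theorem integral_le_of_tendsto {α : Type*} [MeasurableSpace α] {μ : Measure α} {F : ℕ → α → ℝ}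
    {f : α → ℝ} {C : ℝ} (hF : ∀ n, Integrable (F n) μ) (hF0 : ∀ n, 0 ≤ᵐ[μ] F n)
    (hC : ∀ n, ∫ x, F n x ∂μ ≤ C) (hlim : ∀ᵐ x ∂μ, Tendsto (fun n => F n x) atTop (𝓝 (f x))) :
    ∫ x, f x ∂μ ≤ C := by
  have hC0 : 0 ≤ C := (integral_nonneg_of_ae (hF0 0)).trans (hC 0)
  have hf0 : 0 ≤ᵐ[μ] f := by
    filter_upwards [hlim, ae_all_iff.2 hF0] with x hx h0
    exact ge_of_tendsto' hx h0
  rw [integral_eq_lintegral_of_nonneg_ae hf0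
    (aestronglyMeasurable_of_tendsto_ae _ (fun n => (hF n).aestronglyMeasurable) hlim)]
  refine ENNReal.toReal_le_of_le_ofReal hC0 ?_
  calc ∫⁻ x, ENNReal.ofReal (f x) ∂μ
      = ∫⁻ x, liminf (fun n => ENNReal.ofReal (F n x)) atTop ∂μ := by
        refine lintegral_congr_ae ?_
        filter_upwards [hlim] with x hx
        exact ((ENNReal.continuous_ofReal.tendsto _).comp hx).liminf_eq.symm
    _ ≤ liminf (fun n => ∫⁻ x, ENNReal.ofReal (F n x) ∂μ) atTop :=
        lintegral_liminf_le' fun n => (hF n).aemeasurable.ennreal_ofReal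
    _ ≤ ENNReal.ofReal C := by
        refine liminf_le_of_le (by isBoundedDefault) fun b hb => ?_
        obtain ⟨n, hn⟩ := hb.exists
        rw [← ofReal_integral_eq_lintegral_ofReal (hF n) (hF0 n)] at hn
        exact hn.trans (ENNReal.ofReal_le_ofReal (hC n))

theorem circleAverage_le_of_tendsto {F : ℕ → ℂ → ℝ} {f : ℂ → ℝ} {c : ℂ} {R C : ℝ}
    (hF : ∀ n, CircleIntegrable (F n) c R) (hF0 : ∀ n, ∀ z ∈ Metric.sphere c |R|, 0 ≤ F n z)
    (hC : ∀ n, circleAverage (F n) c R ≤ C)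
    (hlim : ∀ z ∈ Metric.sphere c |R|, Tendsto (fun n => F n z) atTop (𝓝 (f z))) :
    circleAverage f c R ≤ C := by
  have hπ : 0 < (2 * π)⁻¹ := by positivity
  simp only [circleAverage_def, smul_eq_mul, ← le_div_iff₀' hπ,
    intervalIntegral.integral_of_le two_pi_pos.le] at hC ⊢
  exact integral_le_of_tendsto
    (fun n => (intervalIntegrable_iff_integrableOn_Ioc_of_le two_pi_pos.le).1 (hF n))
    (fun n => .of_forall fun θ => hF0 n _ (circleMap_mem_sphere' c R θ)) hC
    (.of_forall fun θ => hlim _ (circleMap_mem_sphere' c R θ))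

theorem norm_lt_one_of_mem_sphere {r : ℝ} (hr : r ∈ Set.Ioo (0 : ℝ) 1) {z : ℂ}
    (hz : z ∈ Metric.sphere 0 |r|) : ‖z‖ < 1 := by
  rw [mem_sphere_zero_iff_norm.1 hz, abs_of_pos hr.1]
  exact hr.2

section HardyMeans

variable {p : ℝ} {f g : 𝔻 → ℂ} {r : ℝ}

theorem hpMean_eq_circleAverage {F : ℂ → ℝ} (hr : r ∈ Set.Ioo (0 : ℝ) 1)
    (h : ∀ z : 𝔻, ‖f z‖ ^ p = F z) : hpMean p f r = circleAverage F 0 r :=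
  circleAverage_congr_sphere fun z hz => by
    rw [zeroExt_of_lt f (norm_lt_one_of_mem_sphere hr hz), h, Complex.UnitDisc.coe_mk]

theorem hpMean_congr (hr : r ∈ Set.Ioo (0 : ℝ) 1) (h : ∀ z, ‖f z‖ = ‖g z‖) :
    hpMean p f r = hpMean p g r :=
  hpMean_eq_circleAverage hr fun z => by rw [h, zeroExt_coe]

theorem hpMean_le_of_norm_le (hp : 1 ≤ p) (hf : IsAnalytic f) (hg : IsAnalytic g)
    (hr : r ∈ Set.Ioo (0 : ℝ) 1) (h : ∀ z, ‖f z‖ ≤ ‖g z‖) : hpMean p f r ≤ hpMean p g r := by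
  refine circleAverage_mono (circleIntegrable_of_isAnalytic hp hf hr)
    (circleIntegrable_of_isAnalytic hp hg hr) fun z hz => ?_
  have hz1 := norm_lt_one_of_mem_sphere hr hz
  rw [zeroExt_of_lt f hz1, zeroExt_of_lt g hz1]
  exact Real.rpow_le_rpow (norm_nonneg _) (h _) (by linarith)

theorem monotoneOn_hpMean (hp : 1 ≤ p) (hf : IsAnalytic f) :
    MonotoneOn (hpMean p f) (Set.Ioo 0 1) := fun r hr s hs hrs => by
  obtain rfl | hrs := hrs.eq_or_lt
  · rfl
  refine circleAverage_rpow_norm_mono hp hr.1 hrs (DifferentiableOn.diffContOnCl (hf.mono ?_))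
  rw [closure_ball _ hs.1.ne']
  exact Metric.closedBall_subset_ball hs.2

theorem hpMean_le_of_tendsto {F : ℕ → 𝔻 → ℂ} {C : ℝ} (hp : 1 ≤ p) (hr : r ∈ Set.Ioo (0 : ℝ) 1)
    (hF : ∀ n, IsAnalytic (F n)) (hC : ∀ n, hpMean p (F n) r ≤ C)
    (hlim : ∀ z, Tendsto (fun n => F n z) atTop (𝓝 (f z))) : hpMean p f r ≤ C := by
  refine circleAverage_le_of_tendsto (fun n => circleIntegrable_of_isAnalytic hp (hF n) hr)
    (fun n z _ => by positivity) hC fun z hz => ?_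
  simp only [zeroExt_of_lt _ (norm_lt_one_of_mem_sphere hr hz)]
  exact (hlim _).norm.rpow_const (Or.inr (by linarith))

theorem hpMean_coe_mul (hr : r ∈ Set.Ioo (0 : ℝ) 1) :
    hpMean p (fun z => (z : ℂ) * f z) r = r ^ p * hpMean p f r := by
  rw [hpMean_eq_circleAverage (F := fun z => ‖z‖ ^ p * ‖zeroExt f z‖ ^ p) hr fun z => by
    rw [norm_mul, Real.mul_rpow (norm_nonneg _) (norm_nonneg _), zeroExt_coe], hpMean,
    ← smul_eq_mul, ← circleAverage_fun_smul]
  refine circleAverage_congr_sphere fun z hz => ?_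
  rw [mem_sphere_zero_iff_norm.1 hz, abs_of_pos hr.1, smul_eq_mul]

/-- The `p`-th power of the Hardy space norm. -/
noncomputable def hpSup (p : ℝ) (f : 𝔻 → ℂ) : ℝ := ⨆ r : Set.Ioo (0 : ℝ) 1, hpMean p f r

theorem hpSup_le {C : ℝ} (h : ∀ r ∈ Set.Ioo (0 : ℝ) 1, hpMean p f r ≤ C) : hpSup p f ≤ C :=
  have : Nonempty (Set.Ioo (0 : ℝ) 1) := (Set.nonempty_Ioo.2 one_pos).to_subtype
  ciSup_le fun r => h r r.2

theorem hpSup_congr (h : ∀ z, ‖f z‖ = ‖g z‖) : hpSup p f = hpSup p g :=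
  iSup_congr fun r => hpMean_congr r.2 h

end HardyMeans

section HardySpace

variable {p : ℝ} {hp : 1 ≤ p} {f g : 𝔻 → ℂ}

theorem hpMean_le_hpSup (hf : f ∈ Hp p hp) {r : ℝ} (hr : r ∈ Set.Ioo (0 : ℝ) 1) :
    hpMean p f r ≤ hpSup p f :=
  have ⟨C, hC⟩ := hf.2
  le_ciSup (f := fun r : Set.Ioo (0 : ℝ) 1 => hpMean p f r)
    ⟨C, Set.forall_mem_range.2 fun r => hC r r.2⟩ ⟨r, hr⟩

theorem tendsto_hpMean (hf : f ∈ Hp p hp) :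
    Tendsto (hpMean p f) (𝓝[<] 1) (𝓝 (hpSup p f)) := by
  have ⟨C, hC⟩ := hf.2
  have h := (monotoneOn_hpMean hp hf.1).tendsto_nhdsWithin_Ioo_left (Set.nonempty_Ioo.2 one_pos)
    ⟨C, Set.forall_mem_image.2 hC⟩
  rwa [sSup_image'] at h

theorem mem_Hp_of_norm_le (hf : IsAnalytic f) (hg : g ∈ Hp p hp) (h : ∀ z, ‖f z‖ ≤ ‖g z‖) :
    f ∈ Hp p hp :=
  ⟨hf, hpSup p g, fun _ hr => (hpMean_le_of_norm_le hp hf hg.1 hr h).trans (hpMean_le_hpSup hg hr)⟩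

theorem hpSup_le_of_norm_le (hf : IsAnalytic f) (hg : g ∈ Hp p hp) (h : ∀ z, ‖f z‖ ≤ ‖g z‖) :
    hpSup p f ≤ hpSup p g :=
  hpSup_le fun _ hr => (hpMean_le_of_norm_le hp hf hg.1 hr h).trans (hpMean_le_hpSup hg hr)

theorem hpSup_le_of_tendsto {F : ℕ → 𝔻 → ℂ} {C : ℝ} (hF : ∀ n, F n ∈ Hp p hp)
    (hC : ∀ n, hpSup p (F n) ≤ C) (hlim : ∀ z, Tendsto (fun n => F n z) atTop (𝓝 (f z))) :
    hpSup p f ≤ C :=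
  hpSup_le fun _ hr => hpMean_le_of_tendsto hp hr (fun n => (hF n).1)
    (fun n => (hpMean_le_hpSup (hF n) hr).trans (hC n)) hlim

theorem mem_Hp_of_bounded (hf : IsAnalytic f) {C : ℝ} (h : ∀ z, ‖f z‖ ≤ C) : f ∈ Hp p hp := by
  have hconst : (fun _ => (C : ℂ)) ∈ Hp p hp := ⟨isAnalytic_const _, ‖(C : ℂ)‖ ^ p, fun r hr => by
    rw [hpMean_eq_circleAverage (F := fun _ => ‖(C : ℂ)‖ ^ p) hr fun _ => rfl,
      circleAverage_const]⟩
  refine mem_Hp_of_norm_le hf hconst fun z => (h z).trans ?_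
  rw [Complex.norm_real]
  exact le_abs_self C

theorem IsSchur.norm_mul_le (hg : IsSchur g) (f : 𝔻 → ℂ) (z : 𝔻) : ‖(g * f) z‖ ≤ ‖f z‖ := by
  rw [Pi.mul_apply, norm_mul]
  exact mul_le_of_le_one_left (norm_nonneg _) (hg.norm_le_one z)

theorem IsSchur.mul_mem_Hp (hg : IsSchur g) (hf : f ∈ Hp p hp) : g * f ∈ Hp p hp :=
  mem_Hp_of_norm_le (hg.isAnalytic.mul hf.1) hf (hg.norm_mul_le f)

theorem IsSchur.hpSup_mul_le (hg : IsSchur g) (hf : f ∈ Hp p hp) :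
    hpSup p (g * f) ≤ hpSup p f :=
  hpSup_le_of_norm_le (hg.isAnalytic.mul hf.1) hf (hg.norm_mul_le f)

theorem isSchur_coe : IsSchur ((↑) : 𝔻 → ℂ) :=
  ⟨isAnalytic_of_eq differentiableOn_id fun _ => rfl, fun z => z.norm_lt_one.le⟩

theorem hpSup_coe_mul (hf : f ∈ Hp p hp) : hpSup p (fun z => (z : ℂ) * f z) = hpSup p f := by
  refine tendsto_nhds_unique (tendsto_hpMean (isSchur_coe.mul_mem_Hp hf)) ?_
  have hpow : Tendsto (fun r : ℝ => r ^ p) (𝓝[<] 1) (𝓝 1) := by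
    have h : Tendsto (fun r : ℝ => r ^ p) (𝓝 1) (𝓝 (1 ^ p)) :=
      tendsto_id.rpow_const (Or.inr (by linarith))
    rw [Real.one_rpow] at h
    exact h.mono_left nhdsWithin_le_nhds
  rw [← one_mul (hpSup p f)]
  refine (hpow.mul (tendsto_hpMean hf)).congr' ?_
  filter_upwards [Ioo_mem_nhdsLT one_pos] with r hr
  exact (hpMean_coe_mul hr).symm

end HardySpace

/-! ### The weighted composition operators -/

namespace DiscAut

variable (φ : DiscAut)

theorem conj_lam_mul_deriv {z : ℂ} (hz : ‖z‖ ≤ 1) :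
    conj (φ.lam : ℂ) * deriv φ.eval z =
      (1 - ‖(φ.a : ℂ)‖ ^ 2 : ℝ) * (1 - conj (φ.a : ℂ) * z)⁻¹ ^ 2 := by
  rw [(φ.hasDerivAt_eval hz).deriv]
  push_cast
  rw [inv_pow, ← div_eq_mul_inv, mul_div_assoc', ← mul_assoc, φ.conj_lam_mul_lam, one_mul]

theorem re_inv_den_pos {z : ℂ} (hz : ‖z‖ ≤ 1) : 0 < ((1 - conj (φ.a : ℂ) * z)⁻¹).re := by
  rw [Complex.inv_re]
  refine div_pos ?_ (Complex.normSq_pos.2 (φ.den_ne_zero hz))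
  rw [Complex.sub_re, Complex.one_re, sub_pos]
  exact (Complex.re_le_norm _).trans_lt (norm_conj_mul_lt_one φ.a.norm_lt_one hz)

theorem conj_lam_mul_deriv_mem_slitPlane {z : ℂ} (hz : ‖z‖ ≤ 1) :
    conj (φ.lam : ℂ) * deriv φ.eval z ∈ Complex.slitPlane := by
  rw [φ.conj_lam_mul_deriv hz]
  have hN := φ.one_sub_sq_norm_a_pos
  have hre := φ.re_inv_den_pos hz
  set u := (1 - conj (φ.a : ℂ) * z)⁻¹
  rw [Complex.mem_slitPlane_iff, Complex.re_ofReal_mul, Complex.im_ofReal_mul, pow_two u,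
    Complex.mul_re, Complex.mul_im]
  by_cases hu : u.im = 0
  · left
    rw [hu, mul_zero, sub_zero]
    exact mul_pos hN (mul_pos hre hre)
  · right
    rw [mul_comm u.im, ← two_mul]
    exact mul_ne_zero hN.ne' (mul_ne_zero two_ne_zero (mul_ne_zero hre.ne' hu))

/-- The weight `(conj λ * φ') ^ (1 / p)` as a function on the plane; it is analytic up to the
closed unit disc. -/
noncomputable def weightExt (p : ℝ) (z : ℂ) : ℂ :=
  (conj (φ.lam : ℂ) * deriv φ.eval z) ^ ((1 / p : ℝ) : ℂ)

theorem differentiableOn_weightExt (p : ℝ) :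
    DifferentiableOn ℂ (φ.weightExt p) (Metric.closedBall 0 1) := by
  have hbase : DifferentiableOn ℂ (fun z => conj (φ.lam : ℂ) * deriv φ.eval z)
      (Metric.closedBall 0 1) := by
    refine DifferentiableOn.congr ?_
      fun z hz => φ.conj_lam_mul_deriv (mem_closedBall_zero_iff.1 hz)
    refine ((DifferentiableOn.inv (by fun_prop) fun z hz => ?_).pow 2).const_mul _
    exact φ.den_ne_zero (mem_closedBall_zero_iff.1 hz)
  exact hbase.cpow (differentiableOn_const _) fun z hz =>
    φ.conj_lam_mul_deriv_mem_slitPlane (mem_closedBall_zero_iff.1 hz)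

theorem norm_weightExt_rpow {p : ℝ} (hp : p ≠ 0) {z : ℂ} (hz : ‖z‖ = 1) :
    ‖φ.weightExt p z‖ ^ p = poissonKernel 0 φ.a z := by
  have hden : ‖1 - conj (φ.a : ℂ) * z‖ ^ 2 = ‖z - φ.a‖ ^ 2 := by
    have h := sq_norm_one_sub_conj_mul_sub (φ.a : ℂ) z
    rw [hz] at h
    linarith
  rw [weightExt, Complex.norm_cpow_real, ← Real.rpow_mul (norm_nonneg _), one_div_mul_cancel hp,
    Real.rpow_one, φ.conj_lam_mul_deriv hz.le, norm_mul, norm_pow, norm_inv, inv_pow, hden,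
    Complex.norm_of_nonneg φ.one_sub_sq_norm_a_pos.le, poissonKernel_def, sub_zero, sub_zero, hz,
    one_pow, div_eq_mul_inv]

theorem deriv_inv_eval_mul_deriv_eval (w : 𝔻) :
    deriv φ.inv.eval (φ.map w) * deriv φ.eval w = 1 := by
  have hinv := φ.inv.hasDerivAt_eval (φ.map w).norm_lt_one.le
  have hw := φ.hasDerivAt_eval w.norm_lt_one.le
  have hid : HasDerivAt (φ.inv.eval ∘ φ.eval) 1 (w : ℂ) := by
    refine (hasDerivAt_id (w : ℂ)).congr_of_eventuallyEq ?_
    filter_upwards [Metric.isOpen_ball.mem_nhds (mem_ball_zero_iff.2 w.norm_lt_one)] with v hv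
    exact φ.inv_eval_eval (mem_ball_zero_iff.1 hv).le
  rw [hinv.deriv, hw.deriv]
  exact (hinv.comp (w : ℂ) hw).unique hid

theorem weightExt_inv_map_mul_weightExt (p : ℝ) (w : 𝔻) :
    φ.inv.weightExt p (φ.map w) * φ.weightExt p w = 1 := by
  have hslit := φ.conj_lam_mul_deriv_mem_slitPlane w.norm_lt_one.le
  have hbase : conj (φ.inv.lam : ℂ) * deriv φ.inv.eval (φ.map w) =
      (conj (φ.lam : ℂ) * deriv φ.eval w)⁻¹ := by
    rw [inv_lam, Complex.conj_conj]
    refine eq_inv_of_mul_eq_one_left ?_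
    linear_combination (conj (φ.lam : ℂ) * φ.lam) * φ.deriv_inv_eval_mul_deriv_eval w +
      φ.conj_lam_mul_lam
  rw [weightExt, weightExt, hbase, Complex.inv_cpow _ _ (Complex.mem_slitPlane_iff_arg.1 hslit).1]
  exact inv_mul_cancel₀
    (Complex.cpow_ne_zero_iff.2 (Or.inl (Complex.slitPlane_ne_zero hslit)))

theorem U_apply (p : ℝ) (f : 𝔻 → ℂ) (z : 𝔻) : U p φ f z = φ.weightExt p z * f (φ.map z) := rfl

theorem U_inv_U (p : ℝ) (f : 𝔻 → ℂ) : U p φ.inv (U p φ f) = f := by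
  funext z
  obtain ⟨w, rfl⟩ : ∃ w, φ.map w = z := ⟨_, φ.map_inv_map z⟩
  rw [U_apply, U_apply, inv_map_map, ← mul_assoc, weightExt_inv_map_mul_weightExt, one_mul]

theorem U_U_inv (p : ℝ) (f : 𝔻 → ℂ) : U p φ (U p φ.inv f) = f := by
  simpa only [inv_inv] using φ.inv.U_inv_U p f

theorem isAnalytic_U (p : ℝ) {f : 𝔻 → ℂ} (hf : IsAnalytic f) : IsAnalytic (U p φ f) :=
  (isAnalytic_of_eq ((φ.differentiableOn_weightExt p).mono Metric.ball_subset_closedBall)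
    fun _ => rfl).mul (hf.comp_map φ)

section Isometry

variable {p : ℝ} {hp : 1 ≤ p} {f : 𝔻 → ℂ}

theorem differentiableOn_dilation (hf : IsAnalytic f) {s : ℝ} (hs : s ∈ Set.Ioo (0 : ℝ) 1) :
    DifferentiableOn ℂ (fun z => zeroExt f (s * z)) (Metric.closedBall 0 1) := by
  refine DifferentiableOn.comp hf (by fun_prop) fun z hz => ?_
  rw [mem_ball_zero_iff, norm_mul, Complex.norm_of_nonneg hs.1.le]
  exact mul_lt_one_of_nonneg_of_lt_one_left hs.1.le hs.2 (mem_closedBall_zero_iff.1 hz)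

theorem hpMean_U_le_circleAverage (hp : 1 ≤ p) {F : ℂ → ℂ}
    (hF : DifferentiableOn ℂ F (Metric.closedBall 0 1)) {r : ℝ} (hr : r ∈ Set.Ioo (0 : ℝ) 1) :
    hpMean p (U p φ fun z => F z) r ≤ circleAverage (fun z => ‖F z‖ ^ p) 0 1 := by
  have hmaps : Set.MapsTo φ.eval (Metric.closedBall 0 1) (Metric.closedBall 0 1) := fun z hz =>
    mem_closedBall_zero_iff.2 (φ.norm_eval_le_one (mem_closedBall_zero_iff.1 hz))
  have hdiff : DiffContOnCl ℂ (fun z => φ.weightExt p z * F (φ.eval z)) (Metric.ball 0 1) := by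
    refine DifferentiableOn.diffContOnCl ?_
    rw [closure_ball _ one_ne_zero]
    exact (φ.differentiableOn_weightExt p).mul (hF.comp φ.differentiableOn_eval hmaps)
  calc hpMean p (U p φ fun z => F z) r
      = circleAverage (fun z => ‖φ.weightExt p z * F (φ.eval z)‖ ^ p) 0 r :=
        hpMean_eq_circleAverage hr fun _ => rfl
    _ ≤ circleAverage (fun z => ‖φ.weightExt p z * F (φ.eval z)‖ ^ p) 0 1 :=
        circleAverage_rpow_norm_mono hp hr.1 hr.2 hdiff
    _ = circleAverage (fun z => poissonKernel 0 φ.a z * ‖F (φ.eval z)‖ ^ p) 0 1 := by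
        refine circleAverage_congr_sphere fun z hz => ?_
        rw [abs_one, mem_sphere_zero_iff_norm] at hz
        simp only [norm_mul]
        rw [Real.mul_rpow (norm_nonneg _) (norm_nonneg _), φ.norm_weightExt_rpow (by linarith) hz]
    _ = circleAverage (fun z => ‖F z‖ ^ p) 0 1 :=
        φ.circleAverage_poissonKernel_mul_comp_eval <|
          (hF.continuousOn.mono Metric.sphere_subset_closedBall).norm.rpow_const
            fun _ _ => Or.inr (by linarith)

theorem hpMean_U_dilation_le (hf : f ∈ Hp p hp) {r s : ℝ} (hr : r ∈ Set.Ioo (0 : ℝ) 1)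
    (hs : s ∈ Set.Ioo (0 : ℝ) 1) :
    hpMean p (U p φ fun z => zeroExt f (s * z)) r ≤ hpSup p f := by
  refine (φ.hpMean_U_le_circleAverage hp (differentiableOn_dilation hf.1 hs) hr).trans
    (le_of_eq_of_le ?_ (hpMean_le_hpSup hf hs))
  rw [hpMean, circleAverage_eq_circleAverage_zero_one (R := s)]
  simp only [add_zero]

theorem hpMean_U_le (hf : f ∈ Hp p hp) {r : ℝ} (hr : r ∈ Set.Ioo (0 : ℝ) 1) :
    hpMean p (U p φ f) r ≤ hpSup p f := by
  obtain ⟨s, -, hs, hs1⟩ := exists_seq_strictMono_tendsto' (one_pos : (0 : ℝ) < 1)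
  refine hpMean_le_of_tendsto hp hr (fun n => φ.isAnalytic_U p <| isAnalytic_of_eq
    ((differentiableOn_dilation hf.1 (hs n)).mono Metric.ball_subset_closedBall) fun _ => rfl)
    (fun n => φ.hpMean_U_dilation_le hf hr (hs n)) fun z => ?_
  have hlim : Tendsto (fun n => (s n : ℂ) * φ.map z) atTop (𝓝 (φ.map z)) := by
    simpa using (Complex.continuous_ofReal.tendsto 1).comp hs1 |>.mul_const (φ.map z : ℂ)
  have hcont : ContinuousAt (zeroExt f) (φ.map z) :=
    (hf.1.differentiableAt (Metric.isOpen_ball.mem_nhds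
      (mem_ball_zero_iff.2 (φ.map z).norm_lt_one))).continuousAt
  have h := hcont.tendsto.comp hlim
  rw [zeroExt_coe] at h
  exact h.const_mul _

theorem U_mem_Hp (hf : f ∈ Hp p hp) : U p φ f ∈ Hp p hp :=
  ⟨φ.isAnalytic_U p hf.1, hpSup p f, fun _ hr => φ.hpMean_U_le hf hr⟩

theorem hpSup_U (hf : f ∈ Hp p hp) : hpSup p (U p φ f) = hpSup p f := by
  refine le_antisymm (hpSup_le fun r hr => φ.hpMean_U_le hf hr) ?_
  conv_lhs => rw [← φ.U_inv_U p f]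
  exact hpSup_le fun r hr => φ.inv.hpMean_U_le (φ.U_mem_Hp hf) hr

theorem exists_U_pow_eq (hf : f ∈ Hp p hp) (n : ℕ) : ∃ g ∈ Hp p hp, (U p φ ^ n) g = f := by
  induction n generalizing f with
  | zero => exact ⟨f, hf, rfl⟩
  | succ n ih =>
    obtain ⟨g, hg, rfl⟩ := ih hf
    exact ⟨U p φ.inv g, φ.inv.U_mem_Hp hg, by rw [pow_succ, Module.End.mul_apply, U_U_inv]⟩

end Isometry

end DiscAut

/-! ### Blaschke products -/

section Blaschke

variable {p : ℝ} {hp : 1 ≤ p} {f : 𝔻 → ℂ}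

/-- Conjugating by `U φ.inv` turns multiplication by `φ` into multiplication by the coordinate. -/
theorem DiscAut.hpSup_eval_mul (φ : DiscAut) (hf : f ∈ Hp p hp) :
    hpSup p ((fun z : 𝔻 => φ.eval z) * f) = hpSup p f := by
  have hconj : U p φ.inv ((fun z : 𝔻 => φ.eval z) * f) =
      fun z : 𝔻 => (z : ℂ) * U p φ.inv f z := by
    funext z
    rw [U_apply, U_apply, Pi.mul_apply, ← coe_map, map_inv_map, mul_left_comm]
  rw [← φ.inv.hpSup_U (φ.isSchur_eval.mul_mem_Hp hf), hconj,
    hpSup_coe_mul (φ.inv.U_mem_Hp hf), φ.inv.hpSup_U hf]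

theorem hpSup_prod_eval_mul (b : ℕ → DiscAut) (s : Finset ℕ) (hf : f ∈ Hp p hp) :
    hpSup p ((fun z : 𝔻 => ∏ k ∈ s, (b k).eval z) * f) = hpSup p f := by
  induction s using Finset.induction_on with
  | empty => exact hpSup_congr fun z => by rw [Pi.mul_apply, Finset.prod_empty, one_mul]
  | insert k s hk ih =>
    have hmem := (IsSchur.prod (fun k => (b k).isSchur_eval) s).mul_mem_Hp hf
    simp only [Finset.prod_insert hk]
    rw [← ih, ← (b k).hpSup_eval_mul hmem, ← mul_assoc]
    rfl

/-- `Ψ` is the Blaschke product with the factors `b k`, in the sense of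
`IsInfiniteBlaschkeProduct`. -/
structure IsBlaschkeProduct (b : ℕ → DiscAut) (Ψ : 𝔻 → ℂ) : Prop where
  summable : Summable fun k => 1 - ‖((b k).a : ℂ)‖
  tendsto : TendstoLocallyUniformly
    (fun (n : ℕ) (z : 𝔻) => ∏ k ∈ Finset.range n, (b k).eval z) Ψ atTop

theorem DiscAut.norm_eval_zero (φ : DiscAut) : ‖φ.eval 0‖ = ‖(φ.a : ℂ)‖ := by
  rw [norm_eval, zero_sub, norm_neg, mul_zero, sub_zero, norm_one, div_one]

theorem DiscAut.eval_a (φ : DiscAut) : φ.eval φ.a = 0 := by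
  rw [eval, sub_self, mul_zero, zero_div]

theorem exists_isNormalizedFamily_eval {b : ℕ → DiscAut}
    (hb : Summable fun k => 1 - ‖((b k).a : ℂ)‖) :
    ∃ u : ℕ → Circle, IsNormalizedFamily fun k z => u k * (b k).eval z :=
  exists_isNormalizedFamily (h := fun k z => (b k).eval z) (fun k => (b k).isSchur_eval) <| by
    simpa only [Complex.UnitDisc.coe_zero, DiscAut.norm_eval_zero] using hb

theorem exists_isBlaschkeProduct (a : ℕ → 𝔻) (ha : Summable fun k => 1 - ‖(a k : ℂ)‖) :
    ∃ (b : ℕ → DiscAut) (Ψ : 𝔻 → ℂ), (∀ k, (b k).a = a k) ∧ IsBlaschkeProduct b Ψ := by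
  obtain ⟨u, hu⟩ := exists_isNormalizedFamily_eval (b := fun k => DiscAut.ofZero (a k)) ha
  refine ⟨fun k => ⟨a k, u k⟩, fun z => ∏' k, (u k * (DiscAut.ofZero (a k)).eval z : ℂ),
    fun _ => rfl, ha, ?_⟩
  convert hu.tendstoLocallyUniformly_prod using 4 with n z k
  simp [DiscAut.eval, DiscAut.ofZero, mul_div_assoc]

namespace IsBlaschkeProduct

variable {b : ℕ → DiscAut} {Ψ : 𝔻 → ℂ} (h : IsBlaschkeProduct b Ψ)
include h

theorem isSchur : IsSchur Ψ :=
  IsSchur.of_tendstoLocallyUniformly (fun _ => IsSchur.prod (fun k => (b k).isSchur_eval) _)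
    h.tendsto

theorem apply_a (k : ℕ) : Ψ (b k).a = 0 := by
  refine tendsto_nhds_unique (tendsto_of_tendstoLocallyUniformly h.tendsto (b k).a)
    (tendsto_const_nhds.congr' ?_)
  filter_upwards [eventually_gt_atTop k] with n hn
  exact (Finset.prod_eq_zero (Finset.mem_range.2 hn) (b k).eval_a).symm

theorem tendsto_norm_prod (z : 𝔻) :
    Tendsto (fun n => ∏ k ∈ Finset.range n, ‖(b k).eval z‖) atTop (𝓝 ‖Ψ z‖) := by
  simpa only [norm_prod] using (tendsto_of_tendstoLocallyUniformly h.tendsto z).norm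

theorem norm_apply_eq {u : ℕ → Circle}
    (hu : IsNormalizedFamily fun k z => u k * (b k).eval z) (n : ℕ) (z : 𝔻) :
    ‖Ψ z‖ = ‖∏ k ∈ Finset.range n, (b k).eval z‖ *
      ‖∏' k, (u (k + n) * (b (k + n)).eval z : ℂ)‖ := by
  have hprod (n : ℕ) : ‖∏ k ∈ Finset.range n, (u k * (b k).eval z : ℂ)‖ =
      ∏ k ∈ Finset.range n, ‖(b k).eval z‖ := by
    simp only [norm_prod, norm_mul, Circle.norm_coe, one_mul]
  have htprod : ‖Ψ z‖ = ‖∏' k, (u k * (b k).eval z : ℂ)‖ :=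
    tendsto_nhds_unique (h.tendsto_norm_prod z) <|
      (tendsto_of_tendstoLocallyUniformly hu.tendstoLocallyUniformly_prod z).norm.congr hprod
  rw [htprod, ← hu.prod_mul_tprod_shift n z, norm_mul, hprod, norm_prod]

theorem hpSup_mul (hf : f ∈ Hp p hp) : hpSup p (Ψ * f) = hpSup p f := by
  refine le_antisymm (h.isSchur.hpSup_mul_le hf) ?_
  obtain ⟨u, hu⟩ := exists_isNormalizedFamily_eval h.summable
  set tail : ℕ → 𝔻 → ℂ := fun n z => ∏' k, (u (k + n) * (b (k + n)).eval z : ℂ) with htail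
  have hmem (n : ℕ) : tail n * f ∈ Hp p hp := (hu.shift n).isSchur_tprod.mul_mem_Hp hf
  refine hpSup_le_of_tendsto hmem (fun n => ?_) fun z => ?_
  · rw [← hpSup_prod_eval_mul b (Finset.range n) (hmem n)]
    refine (hpSup_congr fun z => ?_).le
    simp only [Pi.mul_apply, norm_mul, ← mul_assoc, h.norm_apply_eq hu n z, htail]
  · have hlim := (hu.tendsto_tprod_shift z).mul_const (f z)
    rwa [one_mul] at hlim

theorem infinite_range_a : (Set.range fun k => (b k).a).Infinite := fun hfin => by
  obtain ⟨a, -, ha⟩ := Set.exists_max_image _ (fun a : 𝔻 => ‖(a : ℂ)‖) hfin ⟨_, 0, rfl⟩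
  have hle := ge_of_tendsto' h.summable.tendsto_atTop_zero (b := 1 - ‖(a : ℂ)‖)
    fun k => sub_le_sub_left (ha _ ⟨k, rfl⟩) 1
  linarith [a.norm_lt_one]

theorem isHpIsometry_mulOp_mul_U (φ : DiscAut) : IsHpIsometry p hp (mulOp Ψ * U p φ) :=
  fun _ hf => ⟨h.isSchur.mul_mem_Hp (φ.U_mem_Hp hf),
    congrArg (· ^ (1 / p)) ((h.hpSup_mul (φ.U_mem_Hp hf)).trans (φ.hpSup_U hf))⟩

end IsBlaschkeProduct

theorem polynomial_mem_Hp (P : Polynomial ℂ) : (fun z : 𝔻 => P.eval (z : ℂ)) ∈ Hp p hp := by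
  obtain ⟨C, hC⟩ := (isCompact_closedBall (0 : ℂ) 1).exists_bound_of_continuousOn
    P.continuous.continuousOn
  exact mem_Hp_of_bounded (isAnalytic_of_eq P.differentiable.differentiableOn fun _ => rfl)
    fun z => hC z (mem_closedBall_zero_iff.2 z.norm_lt_one.le)

theorem surjective_eval_Hp (s : Finset 𝔻) :
    Function.Surjective ((LinearMap.funLeft ℂ ℂ ((↑) : s → 𝔻)).comp (Hp p hp).subtype) := by
  classical
  exact fun v => ⟨⟨_, polynomial_mem_Hp
    (Lagrange.interpolate Finset.univ (fun z : s => ((z : 𝔻) : ℂ)) v)⟩, funext fun z =>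
    Lagrange.eval_interpolate_at_node v
      (fun _ _ _ _ h => Subtype.ext (Complex.UnitDisc.coe_injective h)) (Finset.mem_univ z)⟩

theorem hasInfiniteCodim_of_zeros {S : Module.End ℂ (𝔻 → ℂ)} {Z : Set 𝔻} (hZ : Z.Infinite)
    (hS : ∀ f, ∀ z ∈ Z, S f z = 0) : HasInfiniteCodim p hp S := fun _ => by
  set N := ((Hp p hp).map S).submoduleOf (Hp p hp)
  obtain ⟨s, hsZ, hs⟩ := hZ.exists_subset_card_eq (Module.finrank ℂ (Hp p hp ⧸ N) + 1)
  have hN : N ≤ LinearMap.ker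
      ((LinearMap.funLeft ℂ ℂ ((↑) : s → 𝔻)).comp (Hp p hp).subtype) := by
    rintro ⟨_, _⟩ ⟨g, -, rfl⟩
    exact LinearMap.mem_ker.2 (funext fun z => hS g z (hsZ z.2))
  have hle := LinearMap.finrank_le_finrank_of_surjective
    (LinearMap.range_eq_top.1 ((N.range_liftQ _ hN).trans
      (LinearMap.range_eq_top.2 (surjective_eval_Hp s))))
  rw [Module.finrank_fintype_fun_eq_card, Fintype.card_coe, hs] at hle
  omega

theorem IsBlaschkeProduct.hasInfiniteCodim_mulOp_mul_U {b : ℕ → DiscAut} {Ψ : 𝔻 → ℂ}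
    (h : IsBlaschkeProduct b Ψ) (φ : DiscAut) : HasInfiniteCodim p hp (mulOp Ψ * U p φ) := by
  refine hasInfiniteCodim_of_zeros h.infinite_range_a ?_
  rintro f _ ⟨k, rfl⟩
  exact mul_eq_zero_of_left (h.apply_a k) _

end Blaschke

/-! ### The intersection of the ranges -/

theorem mulOp_mul_U_pow_apply (p : ℝ) (φ : DiscAut) (Ψ g : 𝔻 → ℂ) (n : ℕ) (z : 𝔻) :
    ((mulOp Ψ * U p φ) ^ n) g z =
      (∏ j ∈ Finset.range n, Ψ (φ.map^[j] z)) * ((U p φ ^ n) g) z := by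
  induction n generalizing z with
  | zero => rw [pow_zero, pow_zero, Finset.range_zero, Finset.prod_empty, one_mul]
  | succ n ih =>
    calc ((mulOp Ψ * U p φ) ^ (n + 1)) g z
        = Ψ z * (φ.weightExt p z * ((mulOp Ψ * U p φ) ^ n) g (φ.map z)) := by
          rw [pow_succ', Module.End.mul_apply]; rfl
      _ = (∏ j ∈ Finset.range n, Ψ (φ.map^[j + 1] z)) * Ψ z *
            (φ.weightExt p z * (U p φ ^ n) g (φ.map z)) := by
          rw [ih]; simp only [Function.iterate_succ_apply]; ring
      _ = (∏ j ∈ Finset.range (n + 1), Ψ (φ.map^[j] z)) * (U p φ ^ (n + 1)) g z := by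
          rw [Finset.prod_range_succ', Function.iterate_zero_apply, pow_succ',
            Module.End.mul_apply, φ.U_apply]

section TrivialIntersection

theorem exists_seq_tendsto_punctured_nhds_zero :
    ∃ c : ℕ → 𝔻, Tendsto (fun k => (c k : ℂ)) atTop (𝓝[≠] 0) := by
  have hball : ∀ᶠ z : ℂ in 𝓝[≠] 0, ‖z‖ < 1 :=
    nhdsWithin_le_nhds ((continuous_norm.tendsto' (0 : ℂ) 0 norm_zero).eventually_lt_const one_pos)
  obtain ⟨c, hc, hlt⟩ := exists_seq_forall_of_frequently hball.frequently
  exact ⟨fun k => Complex.UnitDisc.mk (c k) (hlt k), hc⟩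

theorem exists_isBlaschkeProduct_vanishing_on_orbits {φ : DiscAut}
    (hφ : ∀ c : 𝔻, Tendsto (fun n => ‖(φ.map^[n] c : ℂ)‖) atTop (𝓝 1)) (c : ℕ → 𝔻) :
    ∃ (b : ℕ → DiscAut) (Ψ : 𝔻 → ℂ), IsBlaschkeProduct b Ψ ∧ ∀ k, ∃ n, Ψ (φ.map^[n] (c k)) = 0 := by
  have hfar (k : ℕ) : ∃ n, 1 - ‖(φ.map^[n] (c k) : ℂ)‖ ≤ (1 / 2 : ℝ) ^ k := by
    have hlim := (hφ (c k)).const_sub 1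
    rw [sub_self] at hlim
    exact (hlim.eventually_le_const (by positivity)).exists
  choose n hn using hfar
  obtain ⟨b, Ψ, hb, h⟩ := exists_isBlaschkeProduct (fun k => φ.map^[n k] (c k)) <|
    Summable.of_nonneg_of_le (fun k => sub_nonneg.2 (φ.map^[n k] (c k)).norm_lt_one.le) hn
      summable_geometric_two
  exact ⟨b, Ψ, h, fun k => ⟨n k, hb k ▸ h.apply_a k⟩⟩

variable {p : ℝ} {hp : 1 ≤ p} {φ : DiscAut}

theorem IsSchur.iInf_map_pow_eq_bot {Ψ : 𝔻 → ℂ} (hΨ : IsSchur Ψ) {c : ℕ → 𝔻}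
    (hc : Tendsto (fun k => (c k : ℂ)) atTop (𝓝[≠] 0))
    (hzero : ∀ k, ∃ n, Ψ (φ.map^[n] (c k)) = 0) :
    (⨅ n : ℕ, (Hp p hp).map ((mulOp Ψ * U p φ) ^ (n + 1))) = ⊥ := by
  refine (Submodule.eq_bot_iff _).2 fun f hf => ?_
  rw [Submodule.mem_iInf] at hf
  have hanalytic : IsAnalytic f := by
    obtain ⟨g, hg, rfl⟩ := hf 0
    rw [zero_add, pow_one]
    exact (hΨ.mul_mem_Hp (φ.U_mem_Hp hg)).1
  refine hanalytic.eq_zero_of_tendsto hc fun k => ?_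
  obtain ⟨n, hn⟩ := hzero k
  obtain ⟨g, -, rfl⟩ := hf n
  rw [mulOp_mul_U_pow_apply, Finset.prod_eq_zero (Finset.self_mem_range_succ n) hn, zero_mul]

theorem exists_iInf_map_pow_eq_bot
    (hφ : ∀ c : 𝔻, Tendsto (fun n => ‖(φ.map^[n] c : ℂ)‖) atTop (𝓝 1)) :
    ∃ (b : ℕ → DiscAut) (Ψ : 𝔻 → ℂ), IsBlaschkeProduct b Ψ ∧
      (⨅ n : ℕ, (Hp p hp).map ((mulOp Ψ * U p φ) ^ (n + 1))) = ⊥ := by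
  obtain ⟨c, hc⟩ := exists_seq_tendsto_punctured_nhds_zero
  obtain ⟨b, Ψ, h, hzero⟩ := exists_isBlaschkeProduct_vanishing_on_orbits hφ c
  exact ⟨b, Ψ, h, h.isSchur.iInf_map_pow_eq_bot hc hzero⟩

end TrivialIntersection

section NontrivialIntersection

theorem exists_shifts_tsum_lt_one {d : ℕ → ℝ} (hd0 : ∀ n, 0 ≤ d n) (hd : Summable d) :
    ∃ m : ℕ → ℕ, (∀ j, Summable fun k => d (j + m k)) ∧ (∀ j, ∑' k, d (j + m k) < 1) ∧
      Summable fun j => ∑' k, d (j + m k) := by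
  have hm (k : ℕ) : ∃ m, ∑' j, d (j + m) ≤ (1 / 2) ^ k / 4 :=
    ((tendsto_sum_nat_add d).eventually_le_const (by positivity)).exists
  choose m hm using hm
  have hgeo : HasSum (fun k : ℕ => (1 / 2 : ℝ) ^ k / 4) (2 / 4) := hasSum_geometric_two.div_const 4
  have hcol (k : ℕ) : Summable fun j => d (j + m k) := (summable_nat_add_iff (m k)).2 hd
  have hle (j k : ℕ) : d (j + m k) ≤ (1 / 2) ^ k / 4 :=
    ((hcol k).le_tsum j fun _ _ => hd0 _).trans (hm k)
  have hrow (j : ℕ) : Summable fun k => d (j + m k) :=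
    Summable.of_nonneg_of_le (fun _ => hd0 _) (hle j) hgeo.summable
  have hdouble : Summable fun q : ℕ × ℕ => d (q.2 + m q.1) :=
    (summable_prod_of_nonneg fun _ => hd0 _).2 ⟨hcol, Summable.of_nonneg_of_le
      (fun _ => tsum_nonneg fun _ => hd0 _) hm hgeo.summable⟩
  refine ⟨m, hrow, fun j => ?_, hdouble.prod_symm.prod⟩
  calc ∑' k, d (j + m k) ≤ ∑' k : ℕ, (1 / 2 : ℝ) ^ k / 4 :=
        (hrow j).tsum_le_tsum (hle j) hgeo.summable
    _ = 2 / 4 := hgeo.tsum_eq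
    _ < 1 := by norm_num

theorem IsBlaschkeProduct.one_sub_tsum_le_norm {b : ℕ → DiscAut} {Ψ : 𝔻 → ℂ}
    (h : IsBlaschkeProduct b Ψ) {z : 𝔻} (hz : Summable fun k => 1 - ‖(b k).eval z‖) :
    1 - ∑' k, (1 - ‖(b k).eval z‖) ≤ ‖Ψ z‖ := by
  have hle (k : ℕ) : ‖(b k).eval z‖ ≤ 1 := (b k).norm_eval_le_one z.norm_lt_one.le
  refine ge_of_tendsto' (h.tendsto_norm_prod z) fun n => ?_
  calc 1 - ∑' k, (1 - ‖(b k).eval z‖)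
      ≤ 1 - ∑ k ∈ Finset.range n, (1 - ‖(b k).eval z‖) :=
        sub_le_sub_left (hz.sum_le_tsum _ fun k _ => sub_nonneg.2 (hle k)) 1
    _ ≤ ∏ k ∈ Finset.range n, ‖(b k).eval z‖ :=
        one_sub_sum_one_sub_le_prod _ (fun _ => norm_nonneg _) hle

/-- The zeros are far points of the backward orbit of `0`: by invariance of the pseudo-hyperbolic
distance, the factor with zero `φ⁻ᵐ 0` has modulus `|φ^(m+j) 0|` at `φ^j 0`. -/
theorem exists_isBlaschkeProduct_summable_on_orbit {φ : DiscAut}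
    (hφ : Summable fun n => 1 - ‖(φ.map^[n] 0 : ℂ)‖) :
    ∃ (b : ℕ → DiscAut) (Ψ : 𝔻 → ℂ), IsBlaschkeProduct b Ψ ∧
      (∀ j, Ψ (φ.map^[j] 0) ≠ 0) ∧ Summable fun j => 1 - ‖Ψ (φ.map^[j] 0)‖ := by
  obtain ⟨m, hrow, hlt, hsum⟩ :=
    exists_shifts_tsum_lt_one (fun n => sub_nonneg.2 (φ.map^[n] 0).norm_lt_one.le) hφ
  have hzero (k : ℕ) : ‖(φ.inv.map^[m k] 0 : ℂ)‖ = ‖(φ.map^[0 + m k] 0 : ℂ)‖ := by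
    rw [zero_add, ← φ.norm_ofZero_iterate_inv, Complex.UnitDisc.coe_zero, DiscAut.norm_eval_zero]
    rfl
  obtain ⟨b, Ψ, hb, h⟩ := exists_isBlaschkeProduct (fun k => φ.inv.map^[m k] 0)
    (by simpa only [hzero] using hrow 0)
  have hbz (j k : ℕ) : ‖(b k).eval (φ.map^[j] 0 : 𝔻)‖ = ‖(φ.map^[j + m k] 0 : ℂ)‖ := by
    rw [DiscAut.norm_eval, hb, ← DiscAut.norm_ofZero_eval, φ.norm_ofZero_iterate_inv,
      ← Function.iterate_add_apply, add_comm]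
  have hlower (j : ℕ) : 1 - ∑' k, (1 - ‖(φ.map^[j + m k] 0 : ℂ)‖) ≤ ‖Ψ (φ.map^[j] 0)‖ := by
    simpa only [hbz] using h.one_sub_tsum_le_norm (z := φ.map^[j] 0)
      (by simpa only [hbz] using hrow j)
  exact ⟨b, Ψ, h, fun j => norm_pos_iff.1 ((sub_pos.2 (hlt j)).trans_le (hlower j)),
    Summable.of_nonneg_of_le (fun j => sub_nonneg.2 (h.isSchur.norm_le_one _))
      (fun j => sub_le_comm.1 (hlower j)) hsum⟩

theorem IsNormalizedFamily.tprod_apply_ne_zero {g : ℕ → 𝔻 → ℂ} (hg : IsNormalizedFamily g)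
    {z : 𝔻} (hz : ∀ j, g j z ≠ 0) : ∏' j, g j z ≠ 0 := by
  obtain ⟨n, hn⟩ := ((hg.tendsto_tprod_shift z).eventually_ne one_ne_zero).exists
  rw [← hg.prod_mul_tprod_shift n z]
  exact mul_ne_zero (Finset.prod_ne_zero_iff.2 fun j _ => hz j) hn

variable {p : ℝ} {hp : 1 ≤ p} {φ : DiscAut}

/-- Up to unimodular constants, `F = ∏' j, Ψ ∘ φ^j` is the product of `∏_{j<n} Ψ ∘ φ^j`, the
multiplier in the `n`-th power of the operator, with a bounded analytic tail. -/
theorem IsNormalizedFamily.tprod_mem_iInf_map_pow {Ψ : 𝔻 → ℂ} {u : ℕ → Circle}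
    (hu : IsNormalizedFamily fun j z => u j * (Ψ ∘ φ.map^[j]) z) :
    (fun z => ∏' j, (u j * (Ψ ∘ φ.map^[j]) z : ℂ)) ∈
      ⨅ n : ℕ, (Hp p hp).map ((mulOp Ψ * U p φ) ^ (n + 1)) := by
  refine (Submodule.mem_iInf _).2 fun n => ?_
  have htail := (hu.shift (n + 1)).isSchur_tprod
  have hmem := (Hp p hp).smul_mem (∏ j ∈ Finset.range (n + 1), (u j : ℂ))
    (mem_Hp_of_bounded htail.isAnalytic htail.norm_le_one)
  obtain ⟨g, hg, hgU⟩ := φ.exists_U_pow_eq hmem (n + 1)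
  refine ⟨g, hg, funext fun z => ?_⟩
  rw [mulOp_mul_U_pow_apply, hgU, ← hu.prod_mul_tprod_shift (n + 1) z, Finset.prod_mul_distrib,
    Pi.smul_apply, smul_eq_mul, mul_left_comm, mul_assoc]
  rfl

theorem exists_iInf_map_pow_ne_bot (hφ : Summable fun n => 1 - ‖(φ.map^[n] 0 : ℂ)‖) :
    ∃ (b : ℕ → DiscAut) (Ψ : 𝔻 → ℂ), IsBlaschkeProduct b Ψ ∧
      (⨅ n : ℕ, (Hp p hp).map ((mulOp Ψ * U p φ) ^ (n + 1))) ≠ ⊥ := by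
  obtain ⟨b, Ψ, h, hne, hsum⟩ := exists_isBlaschkeProduct_summable_on_orbit hφ
  obtain ⟨u, hu⟩ := exists_isNormalizedFamily (fun j => h.isSchur.comp_iterate_map φ j) hsum
  exact ⟨b, Ψ, h, (Submodule.ne_bot_iff _).2 ⟨_, hu.tprod_mem_iInf_map_pow, fun h0 =>
    hu.tprod_apply_ne_zero (fun j => mul_ne_zero (Circle.coe_ne_zero _) (hne j)) (congrFun h0 0)⟩⟩

end NontrivialIntersection

end HardyIsometry

open HardyIsometry in
theorem proposition6_general (p : ℝ) (hp : 1 ≤ p) (φ : DiscAut) :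
    (∀ Ψ : 𝔻 → ℂ, IsInfiniteBlaschkeProduct Ψ →
      IsHpIsometry p hp (mulOp Ψ * U p φ) ∧ HasInfiniteCodim p hp (mulOp Ψ * U p φ)) ∧
    (φ.IsParabolic ∨ φ.IsHyperbolic →
      (∃ Ψ : 𝔻 → ℂ, IsInfiniteBlaschkeProduct Ψ ∧
        (⨅ n : ℕ, (Hp p hp).map ((mulOp Ψ * U p φ) ^ (n + 1))) = ⊥) ∧
      (∃ Ψ : 𝔻 → ℂ, IsInfiniteBlaschkeProduct Ψ ∧
        (⨅ n : ℕ, (Hp p hp).map ((mulOp Ψ * U p φ) ^ (n + 1))) ≠ ⊥)) := by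
  refine ⟨fun Ψ ⟨b, hb, hΨ⟩ => ?_, fun hφ => ?_⟩
  · have h : IsBlaschkeProduct b Ψ := ⟨hb, hΨ⟩
    exact ⟨h.isHpIsometry_mulOp_mul_U φ, h.hasInfiniteCodim_mulOp_mul_U φ⟩
  · obtain ⟨⟨w, hw, hfix⟩, hne⟩ := φ.exists_boundary_fixed_point hφ
    have hsum := φ.summable_one_sub_norm_iterate hw hfix hne
    have htend (c : 𝔻) : Filter.Tendsto (fun n => ‖(φ.map^[n] c : ℂ)‖) Filter.atTop (nhds 1) := by
      simpa only [sub_sub_cancel, sub_zero] using (hsum c).tendsto_atTop_zero.const_sub 1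
    obtain ⟨b, Ψ, h, hbot⟩ := exists_iInf_map_pow_eq_bot (p := p) (hp := hp) htend
    obtain ⟨b', Ψ', h', hbot'⟩ := exists_iInf_map_pow_ne_bot (p := p) (hp := hp) (hsum 0)
    exact ⟨⟨Ψ, ⟨b, h.summable, h.tendsto⟩, hbot⟩, ⟨Ψ', ⟨b', h'.summable, h'.tendsto⟩, hbot'⟩⟩

open HardyIsometry in
theorem proposition6 (p : ℝ) (hp : 1 ≤ p) (hp2 : p ≠ 2) (φ : DiscAut)
    (hφ : φ.IsParabolic ∨ φ.IsHyperbolic) :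
    (∀ Ψ : 𝔻 → ℂ, IsInfiniteBlaschkeProduct Ψ →
      IsHpIsometry p hp (mulOp Ψ * U p φ) ∧ HasInfiniteCodim p hp (mulOp Ψ * U p φ)) ∧
    (∃ Ψ : 𝔻 → ℂ, IsInfiniteBlaschkeProduct Ψ ∧
      (⨅ n : ℕ, (Hp p hp).map ((mulOp Ψ * U p φ) ^ (n + 1))) = ⊥) ∧
    (∃ Ψ : 𝔻 → ℂ, IsInfiniteBlaschkeProduct Ψ ∧
      (⨅ n : ℕ, (Hp p hp).map ((mulOp Ψ * U p φ) ^ (n + 1))) ≠ ⊥) := by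
  obtain ⟨hS, hinter⟩ := proposition6_general p hp φ
  exact ⟨hS, hinter hφ⟩
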